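/- **Setting.** Work over $\mathbb C$. Let $X^n\subset\mathbb P V=\mathbb P^{n+a}$ be a complex analytic submanifold, let $\mathcal F^1\to X$ be the bundle of frames $f=(e_0,e_\alpha,e_\mu)$ of $V$ ($1\le\alpha\le n<\mu\le n+a$) with $[e_0]\in X$ and $\langle e_0,e_\alpha\rangle=\hat T_{[e_0]}X$, and let $\omega=f^{-1}df$ be the Maurer–Cartan form pulled back to $\mathcal F^1$. The second fundamental form $II$ has coefficients $q^\mu_{\alpha\beta}=q^\mu_{\beta\alpha}$ defined by $\omega^\mu_\alpha=q^\mu_{\alpha\beta}\omega^\beta_0$, and the Fubini cubic form $F_{3,f}\in S^3T^*\otimes N$ has coefficients defined by $$r^\mu_{\alpha\beta\gamma}\omega^\gamma_0=-dq^\mu_{\alpha\beta}-q^\mu_{\alpha\beta}\omega^0_0-q^\nu_{\alpha\beta}\omega^\mu_\nu+q^\mu_{\alpha\delta}\omega^\delta_\beta+q^\mu_{\beta\delta}\omega^\delta_\alpha .$$ Let $Z\subset\mathbb P W$ be a rank two compact Hermitian symmetric space in its minimal homogeneous embedding, i.e. one of: $Seg(\mathbb P^{k-1}\times\mathbb P^{l-1})$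 with $k,l\ge2$; $G(2,m)$ with $m\ge4$ (Plücker embedding); a smooth quadric hypersurface of dimension at least $2$; the spinor variety $D_5/P_5\subset\mathbb P^{15}$; the Cayley plane $E_6/P_6\subset\mathbb P^{26}$. Let $z\in Z$, let $x\in X$ be a general point (the isomorphism type of $II_{X,y}$ is constant for $y\in X$ near $x$), and suppose $II_{X,x}\cong II_{Z,z}$. Let $f\in\mathcal F^1$ be any frame over $x$. **Graded Lie algebra.** The frame gives $V=L\oplus T\oplus N$ with $L=\langle e_0\rangle$, $T=\langle e_\alpha\rangle$, $N=\langle e_\mu\rangle$, and hence a grading $\mathfrak{gl}(V)=\bigoplus_{k=-2}^{2}\mathfrak{gl}(V)_k$ with $\mathfrak{gl}(V)_{-1}=L^*\otimes T\oplus T^*\otimes N$. Let $q$ be the coefficients of $II$ in $f$; let $\mathfrak g_{-1}\cong T$ be the image of $e_\alpha\mapsto e^0\otimes e_\alpha+q^\mu_{\alpha\beta}e^\beta\otimes e_\mu$, an abelian Lie algebra; let $\mathfrak g_0=\{u\in\mathfrak{gl}(V)_0: u.II=0\}$, where $$(u.II)^\mu_{\alpha\beta}=-u^\mu_\nu q^\nu_{\alpha\beta}+u^\gamma_\alpha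 q^\mu_{\gamma\beta}+u^\gamma_\beta q^\mu_{\alpha\gamma}-u^0_0q^\mu_{\alpha\beta};$$ let $\mathfrak g_1$ be the largest subspace of $\mathfrak{gl}(V)_1$ with $[\mathfrak g_1,\mathfrak g_{-1}]\subset\mathfrak g_0$; and let $\mathfrak g=\mathfrak g_{-1}\oplus\mathfrak g_0\oplus\mathfrak g_1$. The quotient $\mathfrak g^\perp=\mathfrak{gl}(V)/\mathfrak g$ is a graded $T$-module. With $C^{p,q}=\Lambda^qT^*\otimes(\mathfrak g^\perp)_{p-1}$ and the Lie algebra (Chevalley–Eilenberg) differentials, $$H^{1,1}(T,\mathfrak g^\perp)=\frac{\ker(\partial^{1,1}:C^{1,1}\to C^{0,2})}{\operatorname{im}(\partial^{2,0}:C^{2,0}\to C^{1,1})}.$$ **Admissible cubics and fiber motions.** Let $\mathcal A\subset S^3T^*\otimes N$ be the space of cubics $r$ for which there is a linear map $\varphi:T\to\mathfrak{gl}(V)_0$ with $r^\mu_{\beta\gamma\delta}=(\varphi(e_\delta).II)^\mu_{\beta\gamma}$ and such that the structure equation $$(-q^\nu_{\beta\gamma}\omega^\mu_\nu+q^\mu_{\alpha\gamma}\omega^\alpha_\beta+q^\mu_{\alpha\beta}\omega^\alpha_\gamma-q^\mu_{\gamma\beta}\omega^0_0)\wedge\omega^\gamma_0=0$$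 holds when the $\mathfrak{gl}(V)_0$-part of $\omega$ is $\varphi(e_\delta)\,\omega^\delta_0$. Let $\mathcal M$ be the set of differences $F_{3,f'}-F_{3,f}$, where $f'$ runs over the frames of $\mathcal F^1$ over $x$ that have the same $e_0$ as $f$ and induce the same bases of $\hat T_xX/\hat x$ and $V/\hat T_xX$ as $f$. **Proposition.** The coefficients $q$ and $r$ at $f$ exist and are unique, and $F_{3,f}\in\mathcal A$. The set $\mathcal M$ is a linear subspace of $\mathcal A$, and there is a linear isomorphism $$\mathcal A/\mathcal M\;\cong\;H^{1,1}(T,\mathfrak g^\perp)$$ which sends the class of the cubic $r$ given by $\varphi$ to the class of the cocycle $\varphi\bmod\mathfrak g_0:T\to(\mathfrak g^\perp)_0$. In other words, the choices of $F_{3,X,x}$ imposed by the structure equation, modulo motions in the fiber, are isomorphic to $H^{1,1}(T,\mathfrak g^\perp)$. -/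

import Mathlib

open Filter Topology
open scoped LinearAlgebra.Projectivization Matrix

attribute [local instance] LieRing.ofAssociativeRing

noncomputable section

namespace FubiniCubic

/-! ### Submanifolds of projective space and adapted frames -/

section Submanifolds

variable {V : Type*} [NormedAddCommGroup V] [NormedSpace ℂ V]

/-- The cone `X̂ ⊂ V \ {0}` over a subset `X ⊂ ℙV`. -/
def cone (X : Set (ℙ ℂ V)) : Set V :=
  {v | ∃ hv : v ≠ 0, Projectivization.mk ℂ v hv ∈ X}

/-- `X ⊂ ℙV` is a (locally closed, complex) analytic submanifold of dimension `n` and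
codimension `a`: near each of its points the cone over `X` is the zero set of a holomorphic
submersion to `ℂ^a`. -/
def IsAnalyticSubmanifold (n a : ℕ) (X : Set (ℙ ℂ V)) : Prop :=
  Module.finrank ℂ V = n + a + 1 ∧
  ∀ v ∈ cone X, ∃ (U : Set V) (F : V → Fin a → ℂ),
    IsOpen U ∧ v ∈ U ∧ AnalyticOnNhd ℂ F U ∧
    (∀ u ∈ U, Function.Surjective (fderiv ℂ F u)) ∧
    cone X ∩ U = {u ∈ U | F u = 0}

/-- The affine tangent space of `X` along the line spanned by `v`, that is the tangent space at
`v` of the cone over `X`: the span of the velocities of holomorphic curves in the cone. -/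
def affTangent (X : Set (ℙ ℂ V)) (v : V) : Submodule ℂ V :=
  Submodule.span ℂ {w | ∃ c : ℂ → V, AnalyticAt ℂ c 0 ∧ c 0 = v ∧
    (∀ᶠ t in 𝓝 (0 : ℂ), c t ∈ cone X) ∧ deriv c 0 = w}

/-- The index set `{0} ∪ {1, …, n} ∪ {n+1, …, n+a}`. -/
abbrev Idx (n a : ℕ) : Type := Unit ⊕ Fin n ⊕ Fin a

variable {n a : ℕ}

/-- The index `0`. -/
abbrev iL : Idx n a := Sum.inl ()

/-- The indices `α, β, … ∈ {1, …, n}`. -/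
abbrev iT (α : Fin n) : Idx n a := Sum.inr (Sum.inl α)

/-- The indices `μ, ν, … ∈ {n+1, …, n+a}`. -/
abbrev iN (μ : Fin a) : Idx n a := Sum.inr (Sum.inr μ)

/-- A frame `(e_0, e_α, e_μ)` of `V`, seen as an element of `GL(V)`. -/
abbrev Frame (V : Type*) [NormedAddCommGroup V] [NormedSpace ℂ V] (n a : ℕ) : Type _ :=
  Module.Basis (Idx n a) ℂ V

/-- The point `[e_0]` of `ℙV` below a frame. -/
def Frame.point (f : Frame V n a) : ℙ ℂ V := Projectivization.mk ℂ (f iL) (f.ne_zero iL)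

/-- The bundle `𝓕¹` of first order adapted frames of `X`: `[e_0]` is a point of `X` and
`e_0, e_α` span the affine tangent space there. -/
def IsAdapted (X : Set (ℙ ℂ V)) (f : Frame V n a) : Prop :=
  Frame.point f ∈ X ∧
  Submodule.span ℂ (insert (f iL) (Set.range fun α => f (iT α))) = affTangent X (f iL)

/-- A germ at `t = 0` of a holomorphic curve in `𝓕¹`. -/
def IsAdaptedCurve (X : Set (ℙ ℂ V)) (F : ℂ → Frame V n a) : Prop :=
  (∀ i, AnalyticAt ℂ (fun t => F t i) 0) ∧ ∀ᶠ t in 𝓝 (0 : ℂ), IsAdapted X (F t)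

/-- The Maurer-Cartan form `ω = f⁻¹ df` on the velocity at `t = 0` of a curve of frames:
`e_j' = ∑ i, ω^i_j e_i`. -/
def maurerCartan (F : ℂ → Frame V n a) : Matrix (Idx n a) (Idx n a) ℂ :=
  Matrix.of fun i j => (F 0).repr (deriv (fun t => F t j) 0) i

/-- Coefficients `q^μ_{αβ} = q^μ_{βα}` of a tensor in `S²T* ⊗ N`. -/
structure Quad (n a : ℕ) where
  coeff : Fin a → Fin n → Fin n → ℂ
  symm : ∀ μ α β, coeff μ α β = coeff μ β α

/-- Tensors with coefficients `r^μ_{αβγ}` in `T* ⊗ T* ⊗ T* ⊗ N`. -/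
abbrev Cubic (n a : ℕ) : Type := Fin a → Fin n → Fin n → Fin n → ℂ

/-- `q` is the coefficient matrix of the second fundamental form of `X` in the adapted frame `f`:
`ω^μ_α = q^μ_{αβ} ω^β_0` on the tangent space of `𝓕¹` at `f`. -/
def IsSecondFF (X : Set (ℙ ℂ V)) (f : Frame V n a) (q : Quad n a) : Prop :=
  ∀ F : ℂ → Frame V n a, IsAdaptedCurve X F → F 0 = f →
    ∀ μ α, maurerCartan F (iN μ) (iT α) =
      ∑ β, q.coeff μ α β * maurerCartan F (iT β) iL

/-- `r` is the coefficient system of the Fubini cubic form of `X` in the adapted frame `f`: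
`r^μ_{αβγ} ω^γ_0 = - dq^μ_{αβ} - q^μ_{αβ} ω^0_0 - q^ν_{αβ} ω^μ_ν + q^μ_{αδ} ω^δ_β
+ q^μ_{βδ} ω^δ_α` on the tangent space of `𝓕¹` at `f`. -/
def IsFubiniCubic (X : Set (ℙ ℂ V)) (f : Frame V n a) (r : Cubic n a) : Prop :=
  ∀ (F : ℂ → Frame V n a) (q : ℂ → Quad n a), IsAdaptedCurve X F → F 0 = f →
    (∀ᶠ t in 𝓝 (0 : ℂ), IsSecondFF X (F t) (q t)) →
    ∀ μ α β, ∑ γ, r μ α β γ * maurerCartan F (iT γ) iL =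
      - deriv (fun t => (q t).coeff μ α β) 0
      - (q 0).coeff μ α β * maurerCartan F iL iL
      - ∑ ν, (q 0).coeff ν α β * maurerCartan F (iN μ) (iN ν)
      + ∑ δ, (q 0).coeff μ α δ * maurerCartan F (iT δ) (iT β)
      + ∑ δ, (q 0).coeff μ β δ * maurerCartan F (iT δ) (iT α)

/-- The second fundamental forms of `X` at `x` and of `Z` at `z` are isomorphic (by linear
isomorphisms of the lines, the tangent spaces and the normal spaces): they have the same
coefficients in suitable adapted frames. -/
def SecondFFIso {W : Type*} [NormedAddCommGroup W] [NormedSpace ℂ W] (n a : ℕ)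
    (X : Set (ℙ ℂ V)) (x : ℙ ℂ V) (Z : Set (ℙ ℂ W)) (z : ℙ ℂ W) : Prop :=
  ∃ (f : Frame V n a) (h : Frame W n a) (q : Quad n a),
    IsAdapted X f ∧ Frame.point f = x ∧ IsSecondFF X f q ∧
    IsAdapted Z h ∧ Frame.point h = z ∧ IsSecondFF Z h q

/-- `x` is a general point of `X` (to second order): the isomorphism type of the second
fundamental form of `X` is constant on a neighbourhood of `x` in `X`. -/
def IsGeneralPoint (n a : ℕ) (X : Set (ℙ ℂ V)) (x : ℙ ℂ V) : Prop :=
  ∀ᶠ v in 𝓝[cone X] x.rep, ∀ hv : v ≠ 0,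
    SecondFFIso n a X (Projectivization.mk ℂ v hv) X x

/-- Two frames over the same point which induce the same bases of the graded pieces `L = ⟨e_0⟩`,
`T = ⟨e_0, e_α⟩ / L`, `N = V / ⟨e_0, e_α⟩`: they differ by a motion in the fibre. -/
def SameGraded (f f' : Frame V n a) : Prop :=
  f' iL = f iL ∧
  (∀ α, f' (iT α) - f (iT α) ∈ Submodule.span ℂ {f iL}) ∧
  ∀ μ, f' (iN μ) - f (iN μ) ∈
    Submodule.span ℂ (insert (f iL) (Set.range fun α => f (iT α)))

/-- The set of all variations of the Fubini cubic form of `X` under motions in the fibre of `𝓕¹`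
starting at the frame `f`. -/
def fiberVariations (X : Set (ℙ ℂ V)) (f : Frame V n a) : Set (Cubic n a) :=
  {m | ∃ (f' : Frame V n a) (r r' : Cubic n a), IsAdapted X f' ∧ SameGraded f f' ∧
    IsFubiniCubic X f r ∧ IsFubiniCubic X f' r' ∧ m = r' - r}

end Submanifolds

/-! ### The graded Lie algebra of a second fundamental form and the group `H^{1,1}(T, 𝔤^⊥)` -/

section LieAlgebra

variable {n a : ℕ}

/-- `𝔤𝔩(V)` in a frame. -/
abbrev Gl (n a : ℕ) : Type := Matrix (Idx n a) (Idx n a) ℂ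

/-- The position in the filtration `L ⊂ L + T ⊂ V`. -/
def level : Idx n a → ℤ
  | Sum.inl _ => 0
  | Sum.inr (Sum.inl _) => 1
  | Sum.inr (Sum.inr _) => 2

/-- The graded piece `𝔤𝔩(V)_k`; for instance `𝔤𝔩(V)_{-1} = L*⊗T ⊕ T*⊗N`. -/
def glDeg (n a : ℕ) (k : ℤ) : Submodule ℂ (Gl n a) where
  carrier := {A | ∀ i j, level j - level i ≠ k → A i j = 0}
  add_mem' {A B} hA hB i j h := by simp [hA i j h, hB i j h]
  zero_mem' i j _ := rfl
  smul_mem' c A hA i j h := by simp [hA i j h]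

/-- The inclusion `T → L*⊗T ⊕ T*⊗N`, `e_α ↦ e^0 ⊗ e_α + q^μ_{αβ} e^β ⊗ e_μ`. -/
def tangentEmb (q : Quad n a) : (Fin n → ℂ) →ₗ[ℂ] Gl n a where
  toFun v := Matrix.of fun i j =>
    match i, j with
    | Sum.inr (Sum.inl α), Sum.inl _ => v α
    | Sum.inr (Sum.inr μ), Sum.inr (Sum.inl β) => ∑ α, q.coeff μ α β * v α
    | _, _ => 0
  map_add' v w := by
    ext i j
    rcases i with _ | _ | _ <;> rcases j with _ | _ | _ <;>
      simp [mul_add, Finset.sum_add_distrib]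
  map_smul' c v := by
    ext i j
    rcases i with _ | _ | _ <;> rcases j with _ | _ | _ <;>
      simp [Finset.mul_sum, mul_left_comm]

/-- The infinitesimal action of `u ∈ 𝔤𝔩(V)_0` on the second fundamental form (it only involves the
degree zero part of `u`). -/
def actII (q : Quad n a) : Gl n a →ₗ[ℂ] (Fin a → Fin n → Fin n → ℂ) where
  toFun u μ α β :=
    - ∑ ν, u (iN μ) (iN ν) * q.coeff ν α β + ∑ γ, u (iT γ) (iT α) * q.coeff μ γ β
      + ∑ γ, u (iT γ) (iT β) * q.coeff μ α γ - u iL iL * q.coeff μ α β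
  map_add' u v := by
    ext μ α β
    simp only [Matrix.add_apply, add_mul, Finset.sum_add_distrib, Pi.add_apply]
    ring
  map_smul' c u := by
    ext μ α β
    simp only [Matrix.smul_apply, smul_eq_mul, mul_assoc, ← Finset.mul_sum, Pi.smul_apply,
      RingHom.id_apply]
    ring

theorem tangentEmb_lie (q : Quad n a) (v w : Fin n → ℂ) :
    ⁅tangentEmb q v, tangentEmb q w⁆ = 0 := by
  ext i j
  rw [Ring.lie_def]
  rcases i with _ | _ | μ <;> rcases j with _ | _ | _ <;>
    simp [Matrix.mul_apply, tangentEmb]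
  simp only [Finset.sum_mul]
  rw [sub_eq_zero, Finset.sum_comm]
  refine Finset.sum_congr rfl fun α _ => Finset.sum_congr rfl fun β _ => ?_
  rw [q.symm μ α β]; ring

/-- `𝔤_{-1}`, the image of `T`, as an abelian Lie algebra. -/
def gNeg (q : Quad n a) : LieSubalgebra ℂ (Gl n a) where
  toSubmodule := LinearMap.range (tangentEmb q)
  lie_mem' := by
    rintro _ _ ⟨v, rfl⟩ ⟨w, rfl⟩
    rw [tangentEmb_lie]
    exact Submodule.zero_mem _

/-- `𝔤_0`, the annihilator of the second fundamental form in `𝔤𝔩(V)_0`. -/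
def gZero (q : Quad n a) : Submodule ℂ (Gl n a) := glDeg n a 0 ⊓ LinearMap.ker (actII q)

/-- `𝔤_1`, the largest subspace of `𝔤𝔩(V)_1` which `𝔤_{-1}` brackets into `𝔤_0`. -/
def gPos (q : Quad n a) : Submodule ℂ (Gl n a) where
  carrier := {A | A ∈ glDeg n a 1 ∧ ∀ v, ⁅tangentEmb q v, A⁆ ∈ gZero q}
  add_mem' {A B} hA hB := ⟨add_mem hA.1 hB.1, fun v => by
    rw [lie_add]; exact add_mem (hA.2 v) (hB.2 v)⟩
  zero_mem' := ⟨zero_mem _, fun v => by rw [lie_zero]; exact zero_mem _⟩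
  smul_mem' c A hA := ⟨Submodule.smul_mem _ c hA.1, fun v => by
    rw [lie_smul]; exact Submodule.smul_mem _ c (hA.2 v)⟩

theorem tangentEmb_lie_gZero (q : Quad n a) (v : Fin n → ℂ) {u : Gl n a} (hu : u ∈ gZero q) :
    ⁅tangentEmb q v, u⁆ ∈ LinearMap.range (tangentEmb q) := by
  obtain ⟨h0, h1⟩ := hu
  have h0' : ∀ i j, level j - level i ≠ 0 → u i j = 0 := h0
  have e1 (α) : u iL (iT α) = 0 := h0' _ _ (by simp [level])
  have e2 (μ) : u iL (iN μ) = 0 := h0' _ _ (by simp [level])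
  have e3 (α) : u (iT α) iL = 0 := h0' _ _ (by simp [level])
  have e4 (α μ) : u (iT α) (iN μ) = 0 := h0' _ _ (by simp [level])
  have e5 (μ) : u (iN μ) iL = 0 := h0' _ _ (by simp [level])
  have e6 (μ α) : u (iN μ) (iT α) = 0 := h0' _ _ (by simp [level])
  have hII : ∀ μ α β, actII q u μ α β = 0 := fun μ α β => by
    rw [LinearMap.mem_ker.1 h1]; rfl
  refine ⟨fun α => v α * u iL iL - ∑ γ, u (iT α) (iT γ) * v γ, ?_⟩
  ext i j
  rw [Ring.lie_def]
  rcases i with _ | α | μ <;> rcases j with _ | β | ν <;>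
    simp [Matrix.mul_apply, tangentEmb, e1, e2, e3, e4, e5, e6]
  have key : ∑ α, v α * actII q u μ α β = 0 := by simp [hII]
  simp only [actII, LinearMap.coe_mk, AddHom.coe_mk, mul_sub, mul_add, mul_neg,
    Finset.sum_sub_distrib, Finset.sum_add_distrib, Finset.sum_neg_distrib, Finset.mul_sum] at key
  simp only [mul_sub, Finset.sum_sub_distrib, Finset.mul_sum, Finset.sum_mul]
  have s1 : ∑ x, ∑ i, v x * (u (iN μ) (iN i) * q.coeff i x β) =
      ∑ x, ∑ i, u (iN μ) (iN x) * (q.coeff x i β * v i) := by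
    rw [Finset.sum_comm]
    exact Finset.sum_congr rfl fun _ _ => Finset.sum_congr rfl fun _ _ => by ring
  have s2 : ∑ x, ∑ i, v x * (u (iT i) (iT x) * q.coeff μ i β) =
      ∑ x, ∑ i, q.coeff μ x β * (u (iT x) (iT i) * v i) := by
    rw [Finset.sum_comm]
    exact Finset.sum_congr rfl fun _ _ => Finset.sum_congr rfl fun _ _ => by ring
  have s3 : ∑ x, ∑ i, v x * (u (iT i) (iT β) * q.coeff μ x i) =
      ∑ x, ∑ i, q.coeff μ i x * v i * u (iT x) (iT β) := by
    rw [Finset.sum_comm]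
    exact Finset.sum_congr rfl fun _ _ => Finset.sum_congr rfl fun _ _ => by ring
  have s4 : ∑ x, v x * (u iL iL * q.coeff μ x β) = ∑ x, q.coeff μ x β * (v x * u iL iL) :=
    Finset.sum_congr rfl fun _ _ => by ring
  rw [s1, s2, s3, s4] at key
  simp only [q.symm μ _ β] at key s1 s2 s3 s4 ⊢
  linear_combination -key

/-- `𝔤 = 𝔤_{-1} ⊕ 𝔤_0 ⊕ 𝔤_1 ⊂ 𝔤𝔩(V)`, as a module over the abelian Lie algebra `T = 𝔤_{-1}`. -/
def gTotal (q : Quad n a) : LieSubmodule ℂ (gNeg q) (Gl n a) where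
  toSubmodule := LinearMap.range (tangentEmb q) ⊔ gZero q ⊔ gPos q
  lie_mem := by
    rintro ⟨_, v, rfl⟩ m hm
    change ⁅tangentEmb q v, m⁆ ∈ LinearMap.range (tangentEmb q) ⊔ gZero q ⊔ gPos q
    obtain ⟨y, hy, c, hc, rfl⟩ := Submodule.mem_sup.1 hm
    obtain ⟨_, ⟨w, rfl⟩, b, hb, rfl⟩ := Submodule.mem_sup.1 hy
    rw [lie_add, lie_add, tangentEmb_lie, zero_add]
    exact add_mem
      (Submodule.mem_sup_left (Submodule.mem_sup_left (tangentEmb_lie_gZero q v hb)))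
      (Submodule.mem_sup_left (Submodule.mem_sup_right (hc.2 v)))

/-- The `T`-module `𝔤^⊥ = 𝔤𝔩(V) / 𝔤`. -/
abbrev GPerp (q : Quad n a) : Type := Gl n a ⧸ gTotal q

/-- The quotient map `𝔤𝔩(V) → 𝔤^⊥`. -/
def toPerp (q : Quad n a) : Gl n a →ₗ[ℂ] GPerp q :=
  (LieSubmodule.Quotient.mk' (gTotal q) : Gl n a →ₗ[ℂ] GPerp q)

/-- The graded piece `(𝔤^⊥)_k`. -/
def perpDeg (q : Quad n a) (k : ℤ) : Submodule ℂ (GPerp q) := (glDeg n a k).map (toPerp q)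

/-- `C^{p,1} = T* ⊗ (𝔤^⊥)_{p-1}`. -/
def C1 (q : Quad n a) (p : ℤ) :
    Submodule ℂ (LieModule.Cohomology.oneCochain ℂ (gNeg q) (GPerp q)) where
  carrier := {c | ∀ x, c x ∈ perpDeg q (p - 1)}
  add_mem' hc hd x := add_mem (hc x) (hd x)
  zero_mem' _ := zero_mem _
  smul_mem' s _ hc x := Submodule.smul_mem _ s (hc x)

/-- The Lie algebra differential `m ↦ (x ↦ x.m)` from `0`-cochains to `1`-cochains. -/
def dZero (q : Quad n a) :
    GPerp q →ₗ[ℂ] LieModule.Cohomology.oneCochain ℂ (gNeg q) (GPerp q) :=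
  (LieModule.toEnd ℂ (gNeg q) (GPerp q) : gNeg q →ₗ[ℂ] Module.End ℂ (GPerp q)).flip

/-- The kernel of `∂^{p,1}` on `C^{p,1}`. -/
def Z1 (q : Quad n a) (p : ℤ) :
    Submodule ℂ (LieModule.Cohomology.oneCochain ℂ (gNeg q) (GPerp q)) :=
  C1 q p ⊓ LinearMap.ker (LieModule.Cohomology.d₁₂ ℂ (gNeg q) (GPerp q))

/-- The image of `∂^{p+1,0}` on `C^{p+1,0} = (𝔤^⊥)_p`. -/
def B1 (q : Quad n a) (p : ℤ) :
    Submodule ℂ (LieModule.Cohomology.oneCochain ℂ (gNeg q) (GPerp q)) :=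
  (perpDeg q p).map (dZero q)

/-- The Lie algebra cohomology group `H^{p,1}(T, 𝔤^⊥)`. -/
abbrev H1 (q : Quad n a) (p : ℤ) : Type := Z1 q p ⧸ (B1 q p).comap (Z1 q p).subtype

/-- The structure equation for a choice `φ γ ∈ 𝔤𝔩(V)_0` of the values on `e_γ` of the
`𝔤𝔩(V)_0`-component of the Maurer-Cartan form as a combination of semi-basic forms, the
coefficients of the second fundamental form being constant:
`(- q^ν_{βγ} ω^μ_ν + q^μ_{αγ} ω^α_β + q^μ_{αβ} ω^α_γ - q^μ_{γβ} ω^0_0) ∧ ω^γ = 0`. -/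
def StructureEq (q : Quad n a) (φ : Fin n → Gl n a) : Prop :=
  ∀ μ β γ δ, actII q (φ δ) μ β γ - actII q (φ γ) μ β δ = 0

/-- The cubic coefficients which a choice of the `𝔤𝔩(V)_0`-component produces:
`r^μ_{βγδ} ω^δ = - q^ν_{βγ} ω^μ_ν + q^μ_{αγ} ω^α_β + q^μ_{αβ} ω^α_γ - q^μ_{γβ} ω^0_0`. -/
def cubicOf (q : Quad n a) (φ : Fin n → Gl n a) : Cubic n a :=
  fun μ β γ δ => actII q (φ δ) μ β γ

/-- The space of choices of the Fubini cubic form imposed by the structure equation. -/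
def admissible (q : Quad n a) : Submodule ℂ (Cubic n a) where
  carrier := {r | ∃ φ : Fin n → Gl n a, (∀ γ, φ γ ∈ glDeg n a 0) ∧ StructureEq q φ ∧
    r = cubicOf q φ}
  add_mem' := by
    rintro _ _ ⟨φ, h1, h2, rfl⟩ ⟨ψ, k1, k2, rfl⟩
    refine ⟨φ + ψ, fun γ => add_mem (h1 γ) (k1 γ), fun μ β γ δ => ?_, ?_⟩
    · simp only [Pi.add_apply, map_add]
      linear_combination h2 μ β γ δ + k2 μ β γ δ
    · funext μ β γ δ
      simp [cubicOf]
  zero_mem' := ⟨0, fun γ => zero_mem _, fun μ β γ δ => by simp, by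
    funext μ β γ δ; simp [cubicOf]⟩
  smul_mem' := by
    rintro c _ ⟨φ, h1, h2, rfl⟩
    refine ⟨c • φ, fun γ => Submodule.smul_mem _ c (h1 γ), fun μ β γ δ => ?_, ?_⟩
    · simp only [Pi.smul_apply, map_smul, smul_eq_mul]
      linear_combination c * h2 μ β γ δ
    · funext μ β γ δ
      simp [cubicOf]

/-- The admissible cubic `r` and the cocycle `c` come from one choice of the
`𝔤𝔩(V)_0`-component `φ`: `r` is the cubic of `φ` and `c(e_γ)` is the class of `φ γ` in `𝔤^⊥`. -/
def Corresponds (q : Quad n a) (r : admissible q) (c : Z1 q 1) : Prop :=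
  ∃ φ : Fin n → Gl n a, (∀ γ, φ γ ∈ glDeg n a 0) ∧ (r : Cubic n a) = cubicOf q φ ∧
    ∀ γ, (c : gNeg q →ₗ[ℂ] GPerp q) ⟨tangentEmb q (Pi.single γ 1), Pi.single γ 1, rfl⟩ =
      toPerp q (φ γ)

end LieAlgebra

/-! ### The rank two compact Hermitian symmetric spaces in their minimal embeddings -/

section CHSS

/-- The points of `ℙW` whose lines lie in a conical set `S`. -/
def projSet {W : Type*} [AddCommGroup W] [Module ℂ W] (S : Set W) : Set (ℙ ℂ W) :=
  {z | z.rep ∈ S}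

/-- The complexified octonions, as Zorn's vector matrices `(a, u; v, b)`. -/
abbrev Oct : Type := ℂ × (Fin 3 → ℂ) × (Fin 3 → ℂ) × ℂ

/-- Multiplication of complexified octonions. -/
def octMul : Oct → Oct → Oct
  | (a, u, v, b), (a', u', v', b') =>
    (a * a' + u ⬝ᵥ v', a • u' + b' • u - crossProduct v v',
      a' • v + b • v' + crossProduct u u', b * b' + v ⬝ᵥ u')

/-- Conjugation of complexified octonions. -/
def octConj : Oct → Oct
  | (a, u, v, b) => (b, -u, -v, a)

/-- The quadratic norm form of the complexified octonions, `x x̄ = N(x)`. -/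
def octNorm : Oct → ℂ
  | (a, u, v, b) => a * b - u ⬝ᵥ v

/-- The `27`-dimensional space of `3 × 3` Hermitian matrices over the complexified octonions:
diagonal entries `d_i` and off-diagonal entries `x_i` (`x_i` in position `(i+1, i+2)`, indices
mod `3`). -/
abbrev Albert : Type := (Fin 3 → ℂ) × (Fin 3 → Oct)

/-- The quadratic adjoint `A ↦ A^#` on Hermitian octonionic `3 × 3` matrices, given by the
`2 × 2` minors. -/
def albertSharp (A : Albert) : Albert :=
  (fun i => A.1 (i + 1) * A.1 (i + 2) - octNorm (A.2 i),
   fun i => octConj (octMul (A.2 (i + 1)) (A.2 (i + 2))) - A.1 i • A.2 i)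

/-- The even half-spin module `Λ^{even} ℂ⁵` of `Spin₁₀`. -/
abbrev HalfSpin : Type := CliffordAlgebra.evenOdd (0 : QuadraticForm ℂ (Fin 5 → ℂ)) 0

/-- The space of vectors `(u, ξ) ∈ ℂ⁵ ⊕ (ℂ⁵)*` which annihilate a spinor `ψ` by Clifford
multiplication `u ∧ ψ + ξ ⌟ ψ`. -/
def spinorAnnihilator (ψ : HalfSpin) :
    Submodule ℂ ((Fin 5 → ℂ) × Module.Dual ℂ (Fin 5 → ℂ)) :=
  LinearMap.ker (LinearMap.coprod
    ((LinearMap.mulRight ℂ (ψ : CliffordAlgebra (0 : QuadraticForm ℂ (Fin 5 → ℂ)))) ∘ₗ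
      CliffordAlgebra.ι (0 : QuadraticForm ℂ (Fin 5 → ℂ)))
    (CliffordAlgebra.contractLeft.flip
      (ψ : CliffordAlgebra (0 : QuadraticForm ℂ (Fin 5 → ℂ)))))

/-- `Z ⊂ ℙW` is, up to a linear isomorphism, a rank two compact Hermitian symmetric space in its
minimal homogeneous embedding. -/
inductive IsRankTwoCHSS {W : Type*} [AddCommGroup W] [Module ℂ W] : Set (ℙ ℂ W) → Prop
  /-- The Segre variety of rank one matrices. -/
  | segre (k l : ℕ) (hk : 2 ≤ k) (hl : 2 ≤ l) (e : W ≃ₗ[ℂ] Matrix (Fin k) (Fin l) ℂ) :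
      IsRankTwoCHSS (projSet {w | ∃ u v, e w = Matrix.vecMulVec u v})
  /-- The Grassmannian of two-planes in `ℂ^m` in its Plücker embedding. -/
  | grassmannian (m : ℕ) (hm : 4 ≤ m) (e : W ≃ₗ[ℂ] ⋀[ℂ]^2 (Fin m → ℂ)) :
      IsRankTwoCHSS (projSet {w | ∃ u v, e w = exteriorPower.ιMulti ℂ 2 ![u, v]})
  /-- A smooth quadric hypersurface of dimension at least two. -/
  | quadric (Q : QuadraticForm ℂ W) (hW : 4 ≤ Module.finrank ℂ W)
      (hQ : (QuadraticMap.polarBilin Q).Nondegenerate) :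
      IsRankTwoCHSS (projSet {w | Q w = 0})
  /-- The ten-dimensional spinor variety of pure spinors. -/
  | spinor (e : W ≃ₗ[ℂ] HalfSpin) :
      IsRankTwoCHSS (projSet {w | Module.finrank ℂ (spinorAnnihilator (e w)) = 5})
  /-- The complexified Cayley plane. -/
  | cayley (e : W ≃ₗ[ℂ] Albert) :
      IsRankTwoCHSS (projSet {w | albertSharp (e w) = 0})

end CHSS

end FubiniCubic

end

/-! The proposition splits into an algebraic half, valid for any symmetric coefficient system `q`,
and a geometric half.

Algebra: let `choices q` be the maps `φ : T → 𝔤𝔩(V)_0` satisfying the structure equation. An element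
`u` of degree 0 brackets `v ∈ T` into `𝔤_{-1}` up to a defect, and this defect is the contraction of
`u.II` with `v` (`lie_tangentEmb_defect`). Hence the structure equation for `φ` is exactly the
cocycle condition for `φ mod 𝔤_0` (`structureEq_iff`). So `choices q` maps onto the admissible
cubics by `φ ↦ φ.II` and onto the cocycles by `φ ↦ φ mod 𝔤`. Both maps kill precisely the
`𝔤_0`-valued `φ`, and both motions and coboundaries come from the maps `γ ↦ ⁅e_γ, A⁆` with `A` of
degree 1. The induced surjections onto the two quotients therefore have the same kernel
(`ker_choices_eq`), which yields the isomorphism.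

Geometry: near a point the cone over `X` is the zero set of a submersion `F`. Differentiating
`DF(e_0)(e_α) = 0` along curves of adapted frames expresses `II` through `D²F`, and one more
differentiation gives an explicit `cubicFormula` for the Fubini cubic. This proves existence, and
the formula shows the symmetry in the last two indices, which is the structure equation. `F` need
not be homogeneous, so Euler's relations are replaced by identities coming from the homogeneity of
the cone (`fderiv_fderiv_self`, `third_self`, `third_self_self`).

At a general point the coefficients of `II` along a curve of frames stay in one orbit of `GL(T) ×
GL(N)`, so their derivative is of the form `u.II` (`exists_fderiv_action_eq`, proved by comparing
Hausdorff dimensions). This puts the cubic in `admissible q`. Finally, a motion in the fibre with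
degree 1 component `A` changes the formula by `⁅e_γ, A⁆.II` (`IsMotion.cubicFormula_sub`), which
identifies the geometric variations with the algebraic ones. -/

noncomputable section

namespace FubiniCubic

/-! ### Algebra: cubics, cocycles and the comparison of the two quotients. -/

section Algebra

variable {n a : ℕ}

theorem tangentEmb_mem_glDeg (q : Quad n a) (v : Fin n → ℂ) : tangentEmb q v ∈ glDeg n a (-1) := by
  intro i j h
  rcases i with _ | _ | _ <;> rcases j with _ | _ | _ <;> simp_all [tangentEmb, level]

theorem mul_mem_glDeg {A B : Gl n a} {k l : ℤ} (hA : A ∈ glDeg n a k) (hB : B ∈ glDeg n a l) :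
    A * B ∈ glDeg n a (k + l) := by
  intro i j h
  rw [Matrix.mul_apply]
  refine Finset.sum_eq_zero fun m _ => ?_
  by_cases h1 : level m - level i = k
  · rw [hB m j (by omega), mul_zero]
  · rw [hA i m h1, zero_mul]

theorem lie_mem_glDeg {A B : Gl n a} {k l : ℤ} (hA : A ∈ glDeg n a k) (hB : B ∈ glDeg n a l) :
    ⁅A, B⁆ ∈ glDeg n a (k + l) := by
  rw [Ring.lie_def]
  exact sub_mem (mul_mem_glDeg hA hB) (add_comm l k ▸ mul_mem_glDeg hB hA)

theorem tangentEmb_injective (q : Quad n a) : Function.Injective (tangentEmb q) := by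
  intro v w h
  funext α
  have := congrFun (congrFun h (iT α)) iL
  simpa [tangentEmb] using this

theorem mem_gTotal_iff (q : Quad n a) (m : Gl n a) :
    m ∈ gTotal q ↔ ∃ v, ∃ b ∈ gZero q, ∃ c ∈ gPos q, m = tangentEmb q v + b + c := by
  change m ∈ LinearMap.range (tangentEmb q) ⊔ gZero q ⊔ gPos q ↔ _
  constructor
  · intro hm
    obtain ⟨y, hy, c, hc, rfl⟩ := Submodule.mem_sup.1 hm
    obtain ⟨_, ⟨w, rfl⟩, b, hb, rfl⟩ := Submodule.mem_sup.1 hy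
    exact ⟨w, b, hb, c, hc, rfl⟩
  · rintro ⟨v, b, hb, c, hc, rfl⟩
    exact add_mem (add_mem (Submodule.mem_sup_left (Submodule.mem_sup_left ⟨v, rfl⟩))
      (Submodule.mem_sup_left (Submodule.mem_sup_right hb))) (Submodule.mem_sup_right hc)

/-- `𝔤` is a sum of homogeneous pieces, so only its degree 0 piece can contribute to an element of
degree 0. Thus `(𝔤^⊥)_0` is `𝔤𝔩(V)_0 / 𝔤_0`. -/
theorem mem_gTotal_of_degree_zero (q : Quad n a) {m : Gl n a} (hm : m ∈ glDeg n a 0) :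
    m ∈ gTotal q ↔ m ∈ gZero q := by
  rw [mem_gTotal_iff]
  constructor
  · rintro ⟨v, b, hb, c, hc, h⟩
    convert hb
    ext i j
    by_cases hij : level j - level i = 0
    · rw [h, Matrix.add_apply, Matrix.add_apply, tangentEmb_mem_glDeg q v i j (by omega),
        hc.1 i j (by omega), zero_add, add_zero]
    · rw [hm i j hij, hb.1 i j hij]
  · exact fun h => ⟨0, m, h, 0, zero_mem _, by simp⟩

/-- An element of `𝔤𝔩(V)_{-1}` is a pair in `L*⊗T ⊕ T*⊗N`, and `𝔤_{-1}` is the graph of a map from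
the first summand to the second. Membership is the equation of this graph. -/
theorem mem_gTotal_of_degree_neg (q : Quad n a) {m : Gl n a} (hm : m ∈ glDeg n a (-1)) :
    m ∈ gTotal q ↔
      ∀ μ β, m (iN μ) (iT β) = ∑ α, q.coeff μ α β * m (iT α) iL := by
  rw [mem_gTotal_iff]
  constructor
  · rintro ⟨v, b, hb, c, hc, h⟩ μ β
    have e : ∀ i j, level j - level i = -1 → m i j = tangentEmb q v i j := fun i j hij => by
      rw [h, Matrix.add_apply, Matrix.add_apply, hb.1 i j (by omega), hc.1 i j (by omega),
        add_zero, add_zero]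
    rw [e _ _ (by simp [level])]
    simp_rw [e (iT _) iL (by simp [level])]
    simp [tangentEmb]
  · intro h
    refine ⟨fun α => m (iT α) iL, 0, zero_mem _, 0, zero_mem _, ?_⟩
    rw [add_zero, add_zero]
    ext i j
    rcases i with i | i | i <;> rcases j with j | j | j <;>
      first
      | exact h _ _
      | rfl
      | exact hm _ _ (by simp [level])

/-- The failure of `⁅tangentEmb q v, u⁆` to lie in `𝔤_{-1}` is the action of `u` on the second
fundamental form. -/
theorem lie_tangentEmb_defect (q : Quad n a) (v : Fin n → ℂ) {u : Gl n a}
    (hu : u ∈ glDeg n a 0) (μ : Fin a) (β : Fin n) :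
    ⁅tangentEmb q v, u⁆ (iN μ) (iT β) - ∑ α, q.coeff μ α β * ⁅tangentEmb q v, u⁆ (iT α) iL =
      ∑ γ, v γ * actII q u μ β γ := by
  have h0' : ∀ i j, level j - level i ≠ 0 → u i j = 0 := hu
  have e1 (α) : u iL (iT α) = 0 := h0' _ _ (by simp [level])
  have e3 (α) : u (iT α) iL = 0 := h0' _ _ (by simp [level])
  have e4 (α μ) : u (iT α) (iN μ) = 0 := h0' _ _ (by simp [level])
  have e5 (μ) : u (iN μ) iL = 0 := h0' _ _ (by simp [level])
  rw [Ring.lie_def]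
  simp only [Matrix.sub_apply, Matrix.mul_apply, tangentEmb, LinearMap.coe_mk, AddHom.coe_mk,
    Matrix.of_apply, Fintype.sum_sum_type, Finset.univ_unique, Finset.sum_singleton, e1, e3, e4, e5,
    mul_zero, zero_mul, Finset.sum_const_zero, add_zero, zero_add, actII]
  simp only [mul_sub, mul_add, mul_neg, Finset.sum_sub_distrib, Finset.sum_add_distrib,
    Finset.sum_neg_distrib, Finset.mul_sum, Finset.sum_mul]
  -- Each of the four terms of `u.II` contracted with `v` matches one term of the bracket: those in
  -- `s1` and `s2` come from its `T*⊗N` entry, those in `s3` and `s4` from its `L*⊗T` entry.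
  have s1 : ∑ x, ∑ i, v x * (u (iN μ) (iN i) * q.coeff i β x) =
      ∑ x, ∑ i, u (iN μ) (iN x) * (q.coeff x i β * v i) := by
    rw [Finset.sum_comm]
    exact Finset.sum_congr rfl fun _ _ => Finset.sum_congr rfl fun _ _ => by
      rw [q.symm _ β]; ring
  have s2 : ∑ x, ∑ i, v x * (u (iT i) (iT β) * q.coeff μ i x) =
      ∑ x, ∑ i, q.coeff μ i x * v i * u (iT x) (iT β) := by
    rw [Finset.sum_comm]
    exact Finset.sum_congr rfl fun _ _ => Finset.sum_congr rfl fun _ _ => by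
      rw [q.symm μ]; ring
  have s3 : ∑ x, ∑ i, v x * (u (iT i) (iT x) * q.coeff μ β i) =
      ∑ x, ∑ i, q.coeff μ x β * (u (iT x) (iT i) * v i) := by
    rw [Finset.sum_comm]
    exact Finset.sum_congr rfl fun _ _ => Finset.sum_congr rfl fun _ _ => by
      rw [q.symm μ]; ring
  have s4 : ∑ x, v x * (u iL iL * q.coeff μ β x) = ∑ x, q.coeff μ x β * (v x * u iL iL) :=
    Finset.sum_congr rfl fun _ _ => by rw [q.symm μ]; ring
  rw [s1, s2, s3, s4]
  ring

/-- The cubic of a choice of the `𝔤𝔩(V)_0`-component, as a linear map. -/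
def cubicMap (q : Quad n a) : (Fin n → Gl n a) →ₗ[ℂ] Cubic n a where
  toFun := cubicOf q
  map_add' φ ψ := by funext μ β γ δ; simp [cubicOf]
  map_smul' c φ := by funext μ β γ δ; simp [cubicOf]

/-- The choices of the `𝔤𝔩(V)_0`-component which satisfy the structure equation. -/
def choices (q : Quad n a) : Submodule ℂ (Fin n → Gl n a) where
  carrier := {φ | (∀ γ, φ γ ∈ glDeg n a 0) ∧ StructureEq q φ}
  add_mem' := by
    rintro φ ψ ⟨h1, h2⟩ ⟨k1, k2⟩
    refine ⟨fun γ => add_mem (h1 γ) (k1 γ), fun μ β γ δ => ?_⟩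
    simp only [Pi.add_apply, map_add]
    linear_combination h2 μ β γ δ + k2 μ β γ δ
  zero_mem' := ⟨fun γ => zero_mem _, fun μ β γ δ => by simp⟩
  smul_mem' := by
    rintro c φ ⟨h1, h2⟩
    refine ⟨fun γ => Submodule.smul_mem _ c (h1 γ), fun μ β γ δ => ?_⟩
    simp only [Pi.smul_apply, map_smul, smul_eq_mul]
    linear_combination c * h2 μ β γ δ

/-- The choices `γ ↦ ⁅e_γ, A⁆` produced by an endomorphism `A`. -/
def adMap (q : Quad n a) : Gl n a →ₗ[ℂ] (Fin n → Gl n a) where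
  toFun A γ := ⁅tangentEmb q (Pi.single γ 1), A⁆
  map_add' A B := by funext γ; simp
  map_smul' c A := by funext γ; simp

/-- The point of this form is that the right side is totally symmetric in `α`, `β`, `γ`. It gives
the structure equation for `adMap q A`, and it is the expression to which the geometric variation of
the cubic is compared. -/
theorem actII_lie (q : Quad n a) {A : Gl n a} (hA : A ∈ glDeg n a 1) (γ : Fin n) (μ : Fin a)
    (α β : Fin n) :
    actII q ⁅tangentEmb q (Pi.single γ 1), A⁆ μ α β =
      A iL (iT α) * q.coeff μ β γ + A iL (iT β) * q.coeff μ γ α + A iL (iT γ) * q.coeff μ α β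
      - ∑ δ, ∑ ν, A (iT δ) (iN ν) * (q.coeff ν α β * q.coeff μ γ δ + q.coeff ν β γ * q.coeff μ α δ
          + q.coeff ν γ α * q.coeff μ β δ) := by
  have h0' : ∀ i j, level j - level i ≠ 1 → A i j = 0 := hA
  have e0 : A iL iL = 0 := h0' _ _ (by simp [level])
  have e1 (α β) : A (iT β) (iT α) = 0 := h0' _ _ (by simp [level])
  have e3 (α) : A (iT α) iL = 0 := h0' _ _ (by simp [level])
  have e4 (ν μ) : A (iN ν) (iN μ) = 0 := h0' _ _ (by simp [level])
  have e7 (μ) : A iL (iN μ) = 0 := h0' _ _ (by simp [level])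
  rw [Ring.lie_def]
  simp only [actII, Matrix.sub_apply, Matrix.mul_apply, tangentEmb, LinearMap.coe_mk,
    AddHom.coe_mk, Matrix.of_apply, Fintype.sum_sum_type, Finset.univ_unique, Finset.sum_singleton,
    e0, e1, e3, e4, e7, mul_zero, zero_mul, Finset.sum_const_zero, add_zero, zero_add,
    sub_zero, Pi.single_apply, mul_ite, ite_mul, mul_one, one_mul, Finset.sum_ite_eq',
    Finset.mem_univ, if_true, zero_sub]
  simp only [sub_mul, ite_mul, zero_mul, Finset.sum_sub_distrib,
    Finset.sum_ite_eq', Finset.mem_univ, if_true, mul_add, Finset.sum_add_distrib, Finset.sum_mul]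
  have s1 : ∑ x, ∑ i, q.coeff μ γ i * A (iT i) (iN x) * q.coeff x α β =
      ∑ x, ∑ i, A (iT x) (iN i) * (q.coeff i α β * q.coeff μ γ x) := by
    rw [Finset.sum_comm]
    exact Finset.sum_congr rfl fun _ _ => Finset.sum_congr rfl fun _ _ => by ring
  have s2 : ∑ x, ∑ i, A (iT x) (iN i) * q.coeff i γ α * q.coeff μ x β =
      ∑ x, ∑ i, A (iT x) (iN i) * (q.coeff i γ α * q.coeff μ β x) :=
    Finset.sum_congr rfl fun _ _ => Finset.sum_congr rfl fun _ _ => by rw [q.symm μ β]; ring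
  have s3 : ∑ x, ∑ i, A (iT x) (iN i) * q.coeff i γ β * q.coeff μ α x =
      ∑ x, ∑ i, A (iT x) (iN i) * (q.coeff i β γ * q.coeff μ α x) :=
    Finset.sum_congr rfl fun _ _ => Finset.sum_congr rfl fun _ _ => by rw [q.symm _ β γ]; ring
  rw [s1, s2, s3, q.symm μ γ β, q.symm μ γ α]
  ring

theorem adMap_mem_choices (q : Quad n a) {A : Gl n a} (hA : A ∈ glDeg n a 1) :
    adMap q A ∈ choices q := by
  refine ⟨fun γ => lie_mem_glDeg (k := -1) (l := 1) (tangentEmb_mem_glDeg q _) hA, ?_⟩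
  intro μ β γ δ
  have e : ∀ γ, adMap q A γ = ⁅tangentEmb q (Pi.single γ 1), A⁆ := fun _ => rfl
  rw [e, e, actII_lie q hA, actII_lie q hA, sub_eq_zero]
  congr 1
  · rw [q.symm μ γ δ, q.symm μ δ β, q.symm μ γ β]; ring
  · refine Finset.sum_congr rfl fun ε _ => Finset.sum_congr rfl fun ν _ => ?_
    rw [q.symm ν γ δ, q.symm ν δ β, q.symm ν γ β]; ring

/-- The variations of an admissible cubic by the elements of `𝔤𝔩(V)_1`. -/
def motions (q : Quad n a) : Submodule ℂ (admissible q) :=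
  ((glDeg n a 1).map (cubicMap q ∘ₗ adMap q)).comap (admissible q).subtype

theorem cubicMap_mem_admissible (q : Quad n a) {φ : Fin n → Gl n a} (hφ : φ ∈ choices q) :
    cubicMap q φ ∈ admissible q :=
  ⟨φ, hφ.1, hφ.2, rfl⟩

/-- Pulling back to the admissible cubics loses nothing, because every `adMap q A` with `A` of
degree 1 solves the structure equation. -/
theorem map_motions (q : Quad n a) :
    (motions q).map (admissible q).subtype = (glDeg n a 1).map (cubicMap q ∘ₗ adMap q) := by
  rw [motions, Submodule.map_comap_subtype, inf_eq_right]
  rintro _ ⟨A, hA, rfl⟩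
  exact cubicMap_mem_admissible q (adMap_mem_choices q hA)

/-- The cubic of a solution of the structure equation. -/
def choicesToAdmissible (q : Quad n a) : choices q →ₗ[ℂ] admissible q :=
  LinearMap.restrict (cubicMap q) fun _ => cubicMap_mem_admissible q

/-- The element of `𝔤_{-1}` corresponding to `v ∈ T`. -/
def tang (q : Quad n a) (v : Fin n → ℂ) : gNeg q := ⟨tangentEmb q v, v, rfl⟩

/-- The inverse of `tang`. -/
def tangInv (q : Quad n a) : gNeg q →ₗ[ℂ] (Fin n → ℂ) :=
  (LinearEquiv.ofInjective (tangentEmb q) (tangentEmb_injective q)).symm.toLinearMap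

theorem tangInv_tang (q : Quad n a) (v : Fin n → ℂ) : tangInv q (tang q v) = v :=
  (LinearEquiv.ofInjective (tangentEmb q) (tangentEmb_injective q)).symm_apply_eq.2 rfl

theorem exists_tang (q : Quad n a) (x : gNeg q) : ∃ v, x = tang q v := by
  obtain ⟨_, v, rfl⟩ := x
  exact ⟨v, rfl⟩

theorem tang_lie (q : Quad n a) (v w : Fin n → ℂ) : ⁅tang q v, tang q w⁆ = 0 :=
  Subtype.ext (tangentEmb_lie q v w)

/-- The `1`-cochain `e_γ ↦ φ γ mod 𝔤`. -/
def cochainMap (q : Quad n a) :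
    (Fin n → Gl n a) →ₗ[ℂ] LieModule.Cohomology.oneCochain ℂ (gNeg q) (GPerp q) where
  toFun φ :=
    { toFun x := toPerp q (∑ γ, tangInv q x γ • φ γ)
      map_add' x y := by
        rw [← map_add, map_add, ← Finset.sum_add_distrib]
        exact congrArg _ (Finset.sum_congr rfl fun _ _ => add_smul _ _ _)
      map_smul' c x := by
        rw [RingHom.id_apply, ← map_smul, map_smul, Finset.smul_sum]
        exact congrArg _ (Finset.sum_congr rfl fun _ _ => mul_smul _ _ _) }
  map_add' φ ψ := by
    refine LinearMap.ext fun x => ?_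
    change toPerp q _ = toPerp q _ + toPerp q _
    rw [← map_add, ← Finset.sum_add_distrib]
    exact congrArg _ (Finset.sum_congr rfl fun _ _ => smul_add _ _ _)
  map_smul' c φ := by
    refine LinearMap.ext fun x => ?_
    change toPerp q _ = c • toPerp q _
    rw [← map_smul, Finset.smul_sum]
    exact congrArg _ (Finset.sum_congr rfl fun _ _ => by rw [Pi.smul_apply, smul_comm])

theorem cochainMap_apply (q : Quad n a) (φ : Fin n → Gl n a) (v : Fin n → ℂ) :
    cochainMap q φ (tang q v) = toPerp q (∑ γ, v γ • φ γ) := by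
  change toPerp q (∑ γ, tangInv q (tang q v) γ • φ γ) = _
  rw [tangInv_tang]

theorem cochainMap_single (q : Quad n a) (φ : Fin n → Gl n a) (γ : Fin n) :
    cochainMap q φ (tang q (Pi.single γ 1)) = toPerp q (φ γ) := by
  rw [cochainMap_apply, Finset.sum_eq_single γ]
  · simp
  · intro δ _ h
    rw [Pi.single_eq_of_ne h, zero_smul]
  · simp

/-- The bracket term of the Chevalley–Eilenberg differential drops out because `T` is abelian. -/
theorem d₁₂_cochainMap (q : Quad n a) (φ : Fin n → Gl n a) (v w : Fin n → ℂ) :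
    LieModule.Cohomology.d₁₂ ℂ (gNeg q) (GPerp q) (cochainMap q φ) (tang q v) (tang q w) =
      toPerp q (⁅tangentEmb q v, ∑ γ, w γ • φ γ⁆ - ⁅tangentEmb q w, ∑ γ, v γ • φ γ⁆) := by
  rw [LieModule.Cohomology.d₁₂_apply_apply, tang_lie, map_zero, sub_zero, cochainMap_apply,
    cochainMap_apply, map_sub]
  rfl

theorem toPerp_eq_zero (q : Quad n a) (m : Gl n a) : toPerp q m = 0 ↔ m ∈ gTotal q :=
  LieSubmodule.Quotient.mk_eq_zero' (N := gTotal q)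

/-- The difference of brackets has degree -1, so it lies in `𝔤` exactly when its defect from
`𝔤_{-1}` vanishes. By `lie_tangentEmb_defect` that defect is the contraction with `v` and `w` of the
skew part of the cubic in its last two indices. -/
theorem structureEq_iff (q : Quad n a) {φ : Fin n → Gl n a} (hφ : ∀ γ, φ γ ∈ glDeg n a 0) :
    StructureEq q φ ↔ ∀ v w : Fin n → ℂ,
      ⁅tangentEmb q v, ∑ γ, w γ • φ γ⁆ - ⁅tangentEmb q w, ∑ γ, v γ • φ γ⁆ ∈ gTotal q := by
  have hs : ∀ w : Fin n → ℂ, ∑ γ, w γ • φ γ ∈ glDeg n a 0 := fun w =>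
    Submodule.sum_mem _ fun γ _ => Submodule.smul_mem _ _ (hφ γ)
  have hd : ∀ v w : Fin n → ℂ, (⁅tangentEmb q v, ∑ γ, w γ • φ γ⁆ -
      ⁅tangentEmb q w, ∑ γ, v γ • φ γ⁆ ∈ gTotal q ↔
      ∀ μ β, ∑ γ, ∑ δ, v γ * w δ * (actII q (φ δ) μ β γ - actII q (φ γ) μ β δ) = 0) := by
    intro v w
    rw [mem_gTotal_of_degree_neg q (sub_mem
      (lie_mem_glDeg (k := -1) (l := 0) (tangentEmb_mem_glDeg q v) (hs w))
      (lie_mem_glDeg (k := -1) (l := 0) (tangentEmb_mem_glDeg q w) (hs v)))]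
    refine forall₂_congr fun μ β => ?_
    rw [← sub_eq_zero]
    have e1 := lie_tangentEmb_defect q v (hs w) μ β
    have e2 := lie_tangentEmb_defect q w (hs v) μ β
    have : ∑ γ, ∑ δ, v γ * w δ * (actII q (φ δ) μ β γ - actII q (φ γ) μ β δ) =
        ∑ γ, v γ * actII q (∑ γ, w γ • φ γ) μ β γ - ∑ γ, w γ * actII q (∑ γ, v γ • φ γ) μ β γ := by
      simp only [map_sum, map_smul, Finset.sum_apply, Pi.smul_apply, smul_eq_mul, Finset.mul_sum,
        mul_sub, Finset.sum_sub_distrib]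
      congr 1
      · exact Finset.sum_congr rfl fun _ _ => Finset.sum_congr rfl fun _ _ => by ring
      · rw [Finset.sum_comm]
        exact Finset.sum_congr rfl fun _ _ => Finset.sum_congr rfl fun _ _ => by ring
    rw [this, ← e1, ← e2]
    simp only [Matrix.sub_apply, mul_sub, Finset.sum_sub_distrib]
    constructor <;> intro h <;> linear_combination h
  simp_rw [hd]
  constructor
  · intro h v w μ β
    exact Finset.sum_eq_zero fun γ _ => Finset.sum_eq_zero fun δ _ => by rw [h, mul_zero]
  · intro h μ β γ δ
    simpa [Pi.single_apply, ite_mul] using h (Pi.single γ 1) (Pi.single δ 1) μ β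

theorem cochainMap_mem_Z1 (q : Quad n a) {φ : Fin n → Gl n a} (hφ : φ ∈ choices q) :
    cochainMap q φ ∈ Z1 q 1 := by
  refine ⟨fun x => ?_, ?_⟩
  · exact ⟨_, Submodule.sum_mem _ fun γ _ => Submodule.smul_mem _ _ (hφ.1 γ), rfl⟩
  · change LieModule.Cohomology.d₁₂ ℂ (gNeg q) (GPerp q) (cochainMap q φ) = 0
    refine Subtype.ext (LinearMap.ext fun x => LinearMap.ext fun y => ?_)
    obtain ⟨v, rfl⟩ := exists_tang q x
    obtain ⟨w, rfl⟩ := exists_tang q y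
    exact (d₁₂_cochainMap q φ v w).trans
      ((toPerp_eq_zero _ _).2 ((structureEq_iff q hφ.1).1 hφ.2 v w))

/-- The cocycle of a solution of the structure equation. -/
def choicesToCocycle (q : Quad n a) : choices q →ₗ[ℂ] Z1 q 1 :=
  LinearMap.restrict (cochainMap q) fun _ => cochainMap_mem_Z1 q

theorem cochain_ext (q : Quad n a) {c d : LieModule.Cohomology.oneCochain ℂ (gNeg q) (GPerp q)}
    (h : ∀ γ, c (tang q (Pi.single γ 1)) = d (tang q (Pi.single γ 1))) : c = d := by
  have : c ∘ₗ (tangentEmb q).rangeRestrict = d ∘ₗ (tangentEmb q).rangeRestrict :=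
    LinearMap.pi_ext' fun γ => LinearMap.ext_ring (h γ)
  refine LinearMap.ext fun x => ?_
  obtain ⟨v, rfl⟩ := exists_tang q x
  exact LinearMap.congr_fun this v

/-- Any lift of the values on a basis to `𝔤𝔩(V)_0` works: the cocycle condition is the structure
equation of the lift. -/
theorem exists_choices_of_mem_Z1 (q : Quad n a)
    {c : LieModule.Cohomology.oneCochain ℂ (gNeg q) (GPerp q)} (hc : c ∈ Z1 q 1) :
    ∃ φ ∈ choices q, cochainMap q φ = c := by
  have h1 : ∀ γ : Fin n, ∃ u ∈ glDeg n a 0, toPerp q u = c (tang q (Pi.single γ 1)) :=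
    fun γ => hc.1 _
  choose φ hφ0 hφ using h1
  have e : cochainMap q φ = c := cochain_ext q fun γ => by rw [cochainMap_single, ← hφ]
  refine ⟨φ, ⟨hφ0, (structureEq_iff q hφ0).2 fun v w => ?_⟩, e⟩
  have h2 : LieModule.Cohomology.d₁₂ ℂ (gNeg q) (GPerp q) c = 0 := hc.2
  have := d₁₂_cochainMap q φ v w
  rw [e, h2] at this
  exact (toPerp_eq_zero _ _).1 this.symm

theorem cochainMap_adMap (q : Quad n a) (A : Gl n a) :
    cochainMap q (adMap q A) = dZero q (toPerp q A) :=
  cochain_ext q fun γ => by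
    rw [cochainMap_single]
    rfl

/-- Both conditions say that `φ` takes values in `𝔤_0`, the annihilator of `II`. -/
theorem cochainMap_eq_zero_iff (q : Quad n a) {φ : Fin n → Gl n a} (hφ : ∀ γ, φ γ ∈ glDeg n a 0) :
    cochainMap q φ = 0 ↔ cubicMap q φ = 0 := by
  have h1 : cochainMap q φ = 0 ↔ ∀ γ, φ γ ∈ gZero q := by
    constructor
    · intro h γ
      rw [← mem_gTotal_of_degree_zero q (hφ γ), ← toPerp_eq_zero]
      rw [← cochainMap_single, h, LinearMap.zero_apply]
    · intro h
      refine cochain_ext q fun γ => ?_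
      rw [cochainMap_single, LinearMap.zero_apply, toPerp_eq_zero]
      exact (mem_gTotal_of_degree_zero q (hφ γ)).2 (h γ)
  rw [h1]
  constructor
  · intro h
    funext μ β γ δ
    change actII q (φ δ) μ β γ = 0
    rw [LinearMap.mem_ker.1 (h δ).2]; rfl
  · intro h γ
    refine ⟨hφ γ, LinearMap.mem_ker.2 ?_⟩
    funext μ α β
    exact congrFun (congrFun (congrFun (congrFun h μ) α) β) γ

/-- A choice is trivial on either side when it differs from some `adMap q A`, with `A` of degree 1,
by a `𝔤_0`-valued map; the same `A` serves both sides. -/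
theorem ker_choices_eq (q : Quad n a) :
    LinearMap.ker ((motions q).mkQ ∘ₗ choicesToAdmissible q) =
      LinearMap.ker (((B1 q 1).comap (Z1 q 1).subtype).mkQ ∘ₗ choicesToCocycle q) := by
  ext ⟨φ, hφ⟩
  simp only [LinearMap.mem_ker, LinearMap.comp_apply, Submodule.mkQ_apply,
    Submodule.Quotient.mk_eq_zero]
  change (∃ A ∈ glDeg n a 1, cubicMap q (adMap q A) = cubicMap q φ) ↔
    (∃ m ∈ perpDeg q 1, dZero q m = cochainMap q φ)
  have key : ∀ A ∈ glDeg n a 1, (cubicMap q (adMap q A) = cubicMap q φ ↔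
      dZero q (toPerp q A) = cochainMap q φ) := by
    intro A hA
    rw [← cochainMap_adMap, ← sub_eq_zero, ← map_sub, ← sub_eq_zero (a := cochainMap q _),
      ← map_sub, cochainMap_eq_zero_iff]
    exact fun γ => sub_mem ((adMap_mem_choices q hA).1 γ) (hφ.1 γ)
  constructor
  · rintro ⟨A, hA, h⟩
    exact ⟨toPerp q A, ⟨A, hA, rfl⟩, (key A hA).1 h⟩
  · rintro ⟨_, ⟨A, hA, rfl⟩, h⟩
    exact ⟨A, hA, (key A hA).2 h⟩

theorem choicesToAdmissible_surjective (q : Quad n a) :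
    Function.Surjective (choicesToAdmissible q) := by
  rintro ⟨_, φ, h1, h2, rfl⟩
  exact ⟨⟨φ, h1, h2⟩, rfl⟩

theorem choicesToCocycle_surjective (q : Quad n a) : Function.Surjective (choicesToCocycle q) := by
  rintro ⟨c, hc⟩
  obtain ⟨φ, hφ, rfl⟩ := exists_choices_of_mem_Z1 q hc
  exact ⟨⟨φ, hφ⟩, rfl⟩

theorem Corresponds.exists_choices {q : Quad n a} {r : admissible q} {c : Z1 q 1}
    (h : Corresponds q r c) :
    ∃ φ, r = choicesToAdmissible q φ ∧ c = choicesToCocycle q φ := by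
  obtain ⟨r, hr⟩ := r
  obtain ⟨c, hc⟩ := c
  obtain ⟨φ, hφ, hrφ, hcφ⟩ := h
  have hφ' : φ ∈ choices q := by
    refine ⟨hφ, fun μ β γ δ => ?_⟩
    -- `Corresponds` does not ask `φ` to solve the structure equation. That equation depends only on
    -- the cubic, and the cubic of `φ` is also that of a solution `ψ`.
    obtain ⟨ψ, -, hψ, hrψ⟩ := id hr
    have e := hψ μ β γ δ
    have e' : cubicOf q ψ = cubicOf q φ := hrψ.symm.trans hrφ
    have e1 := congrFun (congrFun (congrFun (congrFun e' μ) β) γ) δ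
    have e2 := congrFun (congrFun (congrFun (congrFun e' μ) β) δ) γ
    simp only [cubicOf] at e1 e2
    rw [← e1, ← e2, e]
  exact ⟨⟨φ, hφ'⟩, Subtype.ext hrφ, Subtype.ext (cochain_ext q fun γ =>
    (hcφ γ).trans (cochainMap_single q φ γ).symm)⟩

/-- Two surjections with the same kernel have isomorphic targets. -/
theorem exists_equiv_of_ker_eq {R E F G : Type*} [CommRing R] [AddCommGroup E] [AddCommGroup F]
    [AddCommGroup G] [Module R E] [Module R F] [Module R G] (f : E →ₗ[R] F) (g : E →ₗ[R] G)
    (hf : Function.Surjective f) (hg : Function.Surjective g)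
    (h : LinearMap.ker f = LinearMap.ker g) : ∃ e : F ≃ₗ[R] G, ∀ x, e (f x) = g x := by
  refine ⟨(LinearMap.quotKerEquivOfSurjective f hf).symm ≪≫ₗ Submodule.quotEquivOfEq _ _ h ≪≫ₗ
    LinearMap.quotKerEquivOfSurjective g hg, fun x => ?_⟩
  have : f x = LinearMap.quotKerEquivOfSurjective f hf (Submodule.Quotient.mk x) := rfl
  rw [LinearEquiv.trans_apply, LinearEquiv.trans_apply, this, LinearEquiv.symm_apply_apply]
  rfl

theorem exists_quotient_equiv (q : Quad n a) :
    ∃ e : (admissible q ⧸ motions q) ≃ₗ[ℂ] H1 q 1, ∀ r c, Corresponds q r c →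
      e (Submodule.Quotient.mk r) = Submodule.Quotient.mk c := by
  obtain ⟨e, he⟩ := exists_equiv_of_ker_eq ((motions q).mkQ ∘ₗ choicesToAdmissible q)
    (((B1 q 1).comap (Z1 q 1).subtype).mkQ ∘ₗ choicesToCocycle q)
    ((Submodule.mkQ_surjective (motions q)).comp (choicesToAdmissible_surjective q))
    ((Submodule.mkQ_surjective ((B1 q 1).comap (Z1 q 1).subtype)).comp
      (choicesToCocycle_surjective q)) (ker_choices_eq q)
  refine ⟨e, fun r c h => ?_⟩
  obtain ⟨φ, rfl, rfl⟩ := h.exists_choices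
  exact he φ

end Algebra

end FubiniCubic

namespace FubiniCubic

/-! ### Curves in an orbit are tangent to it. -/

section Orbit

variable {R E : Type*} [NormedRing R] [NormedAlgebra ℂ R] [NormedAddCommGroup E] [NormedSpace ℂ E]
  {ρ : R → E → E}

/-- The identity element acts as the identity map, so the partial derivative in the second variable
at `(1, q)` is the identity. -/
theorem fderiv_action (hρ : ContDiff ℂ 1 fun x : R × E => ρ x.1 x.2) (hone : ∀ q, ρ 1 q = q)
    (q : E) (p : R) (q' : E) :
    fderiv ℂ (fun x : R × E => ρ x.1 x.2) (1, q) (p, q') =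
      fderiv ℂ (fun r => ρ r q) 1 p + q' := by
  have hd : HasFDerivAt (fun x : R × E => ρ x.1 x.2) (fderiv ℂ (fun x : R × E => ρ x.1 x.2) (1, q))
      (1, q) := (hρ.differentiable one_ne_zero _).hasFDerivAt
  have h1 : HasFDerivAt (fun r => ρ r q) _ (1 : R) :=
    HasFDerivAt.comp (g := fun x : R × E => ρ x.1 x.2)
    (f := fun r => (r, q)) (1 : R) hd (hasFDerivAt_prodMk_left (1 : R) q)
  have h2 : HasFDerivAt (fun q => ρ 1 q) _ q := HasFDerivAt.comp (g := fun x : R × E => ρ x.1 x.2)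
    (f := fun q => ((1 : R), q)) q hd (hasFDerivAt_prodMk_right (1 : R) q)
  have h3 : HasFDerivAt (fun q => ρ 1 q) (ContinuousLinearMap.id ℂ E) q := by
    simp only [hone]
    exact hasFDerivAt_id q
  have e := DFunLike.congr_fun (h2.unique h3) q'
  rw [h1.fderiv]
  have : (p, q') = (p, 0) + (0, q') := by simp
  rw [this, map_add]
  congr 1

variable [FiniteDimensional ℂ R]

/-- One-parameter groups generated by the infinitesimal stabilizer stabilize. -/
theorem action_exp_of_fderiv_eq_zero (hρ : ContDiff ℂ 1 fun x : R × E => ρ x.1 x.2)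
    (hone : ∀ q, ρ 1 q = q) (hmul : ∀ r s q, ρ (r * s) q = ρ r (ρ s q)) {q : E} {k : R}
    (hk : fderiv ℂ (fun r => ρ r q) 1 k = 0) : ρ (NormedSpace.exp k) q = q := by
  have := FiniteDimensional.complete ℂ R
  have hl : ∀ r, Differentiable ℂ fun q => ρ r q := fun r =>
    (hρ.differentiable one_ne_zero).comp (by fun_prop : Differentiable ℂ fun q : E => (r, q))
  have hr : Differentiable ℂ fun r => ρ r q :=
    (hρ.differentiable one_ne_zero).comp (by fun_prop : Differentiable ℂ fun r : R => (r, q))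
  have hd : ∀ t : ℂ, HasDerivAt (fun t : ℂ => ρ (NormedSpace.exp (t • k)) q) 0 t := by
    intro t
    have h0 : HasDerivAt (fun s : ℂ => NormedSpace.exp ((s - t) • k)) k t := by
      refine (HasDerivAt.scomp_of_eq (g₁ := fun u : ℂ => NormedSpace.exp (u • k)) t
        (hasDerivAt_exp_smul_const k (t - t)) ((hasDerivAt_id t).sub_const t) rfl).congr_deriv ?_
      rw [sub_self, zero_smul, NormedSpace.exp_zero, one_mul, one_smul]
    have h1 : HasDerivAt (fun s : ℂ => ρ (NormedSpace.exp ((s - t) • k)) q) 0 t := by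
      have := HasFDerivAt.comp_hasDerivAt_of_eq t (hr 1).hasFDerivAt h0 (by simp)
      rwa [hk] at this
    -- The factorization `exp (s k) = exp (t k) * exp ((s - t) k)` carries the vanishing of the
    -- derivative at the identity to every time `t`.
    have h2 : HasDerivAt
        (fun s : ℂ => ρ (NormedSpace.exp (t • k)) (ρ (NormedSpace.exp ((s - t) • k)) q)) 0 t := by
      have := (hl (NormedSpace.exp (t • k)) _).hasFDerivAt.comp_hasDerivAt t h1
      rwa [map_zero] at this
    refine h2.congr_of_eventuallyEq (Filter.Eventually.of_forall fun s => ?_)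
    have hc : Commute (t • k) ((s - t) • k) :=
      ((Commute.refl k).smul_left t).smul_right (s - t)
    change ρ (NormedSpace.exp (s • k)) q =
      ρ (NormedSpace.exp (t • k)) (ρ (NormedSpace.exp ((s - t) • k)) q)
    rw [← hmul, ← NormedSpace.exp_add_of_commute_of_mem_ball (𝕂 := ℂ) hc, ← add_smul,
      add_sub_cancel]
    all_goals simp [NormedSpace.expSeries_radius_eq_top]
  have := is_const_of_deriv_eq_zero (fun t => (hd t).differentiableAt) (fun t => (hd t).deriv) 1 0
  simpa [hone] using this

/-- Near the identity, every element is a product of an element of a complement of a subspace `K`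
and of the exponential of an element of `K`. -/
theorem eventually_exists_eq_mul_exp {S K : Submodule ℂ R} (hS : S ⊔ K = ⊤) :
    ∀ᶠ p in 𝓝 (1 : R), ∃ s ∈ S, ∃ k ∈ K, p = (1 + s) * NormedSpace.exp k := by
  have := FiniteDimensional.complete ℂ R
  let s : S × K →L[ℂ] R := S.subtypeL ∘L ContinuousLinearMap.fst ℂ _ _
  let k : S × K →L[ℂ] R := K.subtypeL ∘L ContinuousLinearMap.snd ℂ _ _
  have he : HasStrictFDerivAt (fun x : S × K => NormedSpace.exp (k x)) k 0 := by
    have h : HasStrictFDerivAt (NormedSpace.exp : R → R) (1 : R →L[ℂ] R) (k 0) := by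
      rw [map_zero]; exact hasStrictFDerivAt_exp_zero (𝕂 := ℂ)
    exact h.comp 0 k.hasStrictFDerivAt
  have hθ : HasStrictFDerivAt (fun x : S × K => (1 + s x) * NormedSpace.exp (k x)) (s + k) 0 := by
    refine ((s.hasStrictFDerivAt.const_add 1).mul' he).congr_fderiv ?_
    refine ContinuousLinearMap.ext fun x => ?_
    change (1 + s 0) * k x + s x * NormedSpace.exp (k 0) = s x + k x
    rw [map_zero, map_zero, NormedSpace.exp_zero, add_zero, one_mul, mul_one, add_comm]
  have hr : (s + k).range = ⊤ := by
    rw [eq_top_iff]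
    intro p _
    obtain ⟨s, hs, k, hk, rfl⟩ := Submodule.mem_sup.1 (hS ▸ Submodule.mem_top : p ∈ S ⊔ K)
    exact ⟨(⟨s, hs⟩, ⟨k, hk⟩), rfl⟩
  -- The map `(s, k) ↦ (1 + s) exp k` has the surjective strict derivative `s + k` at 0, so it sends
  -- neighbourhoods of 0 onto neighbourhoods of 1.
  have hm := hθ.map_nhds_eq_of_surj hr
  simp only [map_zero, add_zero, NormedSpace.exp_zero, mul_one] at hm
  rw [← hm]
  exact Filter.mem_map.2 (Filter.univ_mem' fun x => ⟨x.1, x.1.2, x.2, x.2.2, rfl⟩)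

/-- The dimension of an orbit is at most the dimension of a complement of the infinitesimal
stabilizer. -/
theorem dimH_orbit_le [FiniteDimensional ℂ E] (hρ : ContDiff ℂ 1 fun x : R × E => ρ x.1 x.2)
    (hone : ∀ q, ρ 1 q = q) (hmul : ∀ r s q, ρ (r * s) q = ρ r (ρ s q)) (q : E)
    {S : Submodule ℂ R} (hS : S ⊔ LinearMap.ker (fderiv ℂ (fun r => ρ r q) 1).toLinearMap = ⊤) :
    dimH {q' | ∃ u : Rˣ, q' = ρ u q} ≤ Module.finrank ℝ S := by
  have := FiniteDimensional.complete ℂ R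
  have : ProperSpace R := FiniteDimensional.proper ℂ R
  let g : R → S → E := fun u s => ρ (u * (1 + s)) q
  have hg : ∀ u, ContDiff ℝ 1 (g u) := by
    intro u
    refine ContDiff.restrict_scalars ℝ (𝕜' := ℂ) ?_
    have h1 : ContDiff ℂ 1 fun s : S => (s : R) := S.subtypeL.contDiff
    exact hρ.comp (f := fun s : S => (u * (1 + (s : R)), q)) (by fun_prop)
  let f : R → Set R := fun u => {p | ρ p q ∈ Set.range (g u)}
  have hf : ∀ u ∈ {u : R | IsUnit u}, f u ∈ 𝓝[{u : R | IsUnit u}] u := by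
    rintro _ ⟨u, rfl⟩
    refine mem_nhdsWithin_of_mem_nhds ?_
    have hc : Tendsto (fun p : R => (↑u⁻¹ : R) * p) (𝓝 ↑u) (𝓝 1) := by
      have : Continuous (fun p : R => (↑u⁻¹ : R) * p) := by fun_prop
      simpa using this.tendsto ↑u
    filter_upwards [hc.eventually (eventually_exists_eq_mul_exp hS)] with p hp
    obtain ⟨s, hs, k, hk, he⟩ := hp
    refine ⟨⟨s, hs⟩, ?_⟩
    -- The factor `exp k` fixes `q`, so near `u` the orbit map takes values in the smooth image `g
    -- u` of `S` alone.
    have e : p = u * (1 + s) * NormedSpace.exp k := by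
      rw [mul_assoc, ← he, ← mul_assoc, Units.mul_inv, one_mul]
    change ρ _ q = _
    rw [e, hmul _ (NormedSpace.exp k), action_exp_of_fderiv_eq_zero hρ hone hmul hk]
  -- By the Lindelöf property countably many such neighbourhoods cover the units, so the orbit lies
  -- in a countable union of `C¹` images of `S`, none of dimension above that of `S`.
  obtain ⟨s, -, hs, hs'⟩ := TopologicalSpace.countable_cover_nhdsWithin hf
  have hsub : {q' | ∃ u : Rˣ, q' = ρ u q} ⊆ ⋃ u ∈ s, Set.range (g u) := by
    rintro _ ⟨u, rfl⟩
    obtain ⟨p, hp, hup⟩ := Set.mem_iUnion₂.1 (hs' u.isUnit)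
    exact Set.mem_iUnion₂.2 ⟨p, hp, hup⟩
  refine (dimH_mono hsub).trans ?_
  rw [dimH_bUnion hs]
  exact iSup₂_le fun u _ => (hg u).dimH_range_le

/-- A curve contained in an orbit is tangent to the orbit. -/
theorem exists_fderiv_action_eq [FiniteDimensional ℂ E]
    (hρ : ContDiff ℂ 1 fun x : R × E => ρ x.1 x.2)
    (hone : ∀ q, ρ 1 q = q) (hmul : ∀ r s q, ρ (r * s) q = ρ r (ρ s q)) (q : E)
    {c : ℂ → E} {c' : E} (hc : HasStrictDerivAt c c' 0) (hc0 : c 0 = q)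
    (horb : ∀ᶠ t in 𝓝 (0 : ℂ), ∃ u : Rˣ, c t = ρ u q) :
    ∃ p, fderiv ℂ (fun r => ρ r q) 1 p = c' := by
  have := FiniteDimensional.complete ℂ R
  have := FiniteDimensional.complete ℂ E
  by_contra hcon
  set δ := fderiv ℂ (fun r => ρ r q) 1
  obtain ⟨S, hS⟩ := (LinearMap.ker δ.toLinearMap).exists_isCompl
  have hdim := dimH_orbit_le hρ hone hmul q (S := S) (by rw [sup_comm]; exact hS.sup_eq_top)
  -- If `c'` were not tangent to the orbit, `L` would be injective: `δ` is injective on the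
  -- complement `S` of its kernel, and `c'` is outside its range.
  let L : S × ℂ →L[ℂ] E := (δ ∘L S.subtypeL).coprod (ContinuousLinearMap.toSpanSingleton ℂ c')
  have hL : LinearMap.ker L.toLinearMap = ⊥ := by
    rw [LinearMap.ker_eq_bot']
    rintro ⟨s, t⟩ h
    have h : δ s + t • c' = 0 := h
    have ht : t = 0 := by
      by_contra ht
      refine hcon ⟨-t⁻¹ • s, ?_⟩
      rw [map_smul, eq_neg_of_add_eq_zero_left h, smul_neg, neg_smul, neg_neg, smul_smul,
        inv_mul_cancel₀ ht, one_smul]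
    subst ht
    have hs : (s : R) ∈ LinearMap.ker δ.toLinearMap := by simpa using h
    have := (Submodule.disjoint_def.1 hS.disjoint) _ hs s.2
    simpa using this
  obtain ⟨π, hπ⟩ := L.toLinearMap.exists_leftInverse_of_injective hL
  let pr : E →L[ℂ] S × ℂ := LinearMap.toContinuousLinearMap π
  -- `Ψ` moves the curve by the group. Near 0 it stays in the orbit and has derivative `L`, so a
  -- left inverse of `L` makes it a local diffeomorphism of `S × ℂ`.
  let Ψ : S × ℂ → E := fun x => ρ (1 + x.1) (c x.2)
  have hΨ : HasStrictFDerivAt Ψ L 0 := by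
    have h1 : HasStrictFDerivAt (fun x : R × E => ρ x.1 x.2)
        (fderiv ℂ (fun x : R × E => ρ x.1 x.2) (1, q)) (1, q) :=
      (hρ.contDiffAt).hasStrictFDerivAt one_ne_zero
    have h2 : HasStrictFDerivAt (fun x : S × ℂ => ((1 : R) + x.1, c x.2))
      ((S.subtypeL ∘L ContinuousLinearMap.fst ℂ S ℂ).prod
        (ContinuousLinearMap.toSpanSingleton ℂ c' ∘L ContinuousLinearMap.snd ℂ S ℂ)) 0 := by
      refine HasStrictFDerivAt.prodMk ?_ ?_
      · exact (S.subtypeL ∘L ContinuousLinearMap.fst ℂ S ℂ).hasStrictFDerivAt.const_add 1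
      · exact HasStrictFDerivAt.comp (0 : S × ℂ) (g := c) hc.hasStrictFDerivAt
          (ContinuousLinearMap.snd ℂ S ℂ).hasStrictFDerivAt
    have h3 := HasStrictFDerivAt.comp (0 : S × ℂ) (g := fun x : R × E => ρ x.1 x.2)
      (f := fun x : S × ℂ => ((1 : R) + x.1, c x.2)) (by simpa [hc0] using h1) h2
    refine h3.congr_fderiv
      (ContinuousLinearMap.ext fun x => ?_)
    exact fderiv_action hρ hone q x.1 (x.2 • c')
  have hid : HasStrictFDerivAt (fun x => pr (Ψ x)) (ContinuousLinearMap.id ℂ (S × ℂ)) 0 := by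
    refine (pr.hasStrictFDerivAt.comp (0 : S × ℂ) hΨ).congr_fderiv
      (ContinuousLinearMap.ext fun x => ?_)
    exact LinearMap.congr_fun hπ x
  have hm := hid.map_nhds_eq_of_surj (LinearMap.range_id)
  have hmem : ∀ᶠ x in 𝓝 (0 : S × ℂ), Ψ x ∈ {q' | ∃ u : Rˣ, q' = ρ u q} := by
    have h1 : Tendsto (fun x : S × ℂ => (1 : R) + x.1) (𝓝 0) (𝓝 1) := by
      have : Continuous (fun x : S × ℂ => (1 : R) + x.1) := by fun_prop
      simpa using this.tendsto 0
    have h2 : Tendsto (fun x : S × ℂ => x.2) (𝓝 0) (𝓝 0) := continuous_snd.tendsto 0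
    filter_upwards [h1.eventually (Units.isOpen.mem_nhds (isUnit_one : IsUnit (1 : R))),
      h2.eventually horb] with x hx hx'
    obtain ⟨u, hu⟩ := hx
    obtain ⟨v, hv⟩ := hx'
    exact ⟨u * v, by simp only [Ψ]; rw [hv, ← hu, Units.val_mul, hmul]⟩
  -- A Lipschitz projection of the orbit contains an open subset of `S × ℂ`, so the orbit has at
  -- least the real dimension of that space. This exceeds the bound `dim S` by 2.
  have hnh : pr '' {q' | ∃ u : Rˣ, q' = ρ u q} ∈ 𝓝 (pr (Ψ 0)) := by
    rw [← hm]
    exact Filter.mem_map.2 (hmem.mono fun x hx => ⟨_, hx, rfl⟩)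
  have hge := Real.dimH_of_mem_nhds hnh
  have hle := (pr.lipschitz.dimH_image_le _).trans hdim
  rw [hge] at hle
  have hfin : Module.finrank ℝ (S × ℂ) ≤ Module.finrank ℝ S := by exact_mod_cast hle
  have : FiniteDimensional ℝ S := FiniteDimensional.complexToReal S
  rw [Module.finrank_prod, Complex.finrank_real_complex] at hfin
  omega

end Orbit

end FubiniCubic

namespace FubiniCubic

/-! ### The action of `GL(T) × GL(N)` on `S²T* ⊗ N`. -/

section TensorAction

variable {n a : ℕ}

/-- The linear change of coordinates `(A, B)` acting on coefficients in `S²T* ⊗ N`. -/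
def tensorAct (r : Matrix (Fin n) (Fin n) ℂ × Matrix (Fin a) (Fin a) ℂ)
    (q : Fin a → Fin n → Fin n → ℂ) : Fin a → Fin n → Fin n → ℂ :=
  fun μ α β => ∑ ν, ∑ γ, ∑ δ, r.2 μ ν * r.1 α γ * r.1 β δ * q ν γ δ

theorem tensorAct_one (q : Fin a → Fin n → Fin n → ℂ) : tensorAct 1 q = q := by
  funext μ α β
  simp [tensorAct, Matrix.one_apply]

theorem tensorAct_mul (r s : Matrix (Fin n) (Fin n) ℂ × Matrix (Fin a) (Fin a) ℂ)
    (q : Fin a → Fin n → Fin n → ℂ) : tensorAct (r * s) q = tensorAct r (tensorAct s q) := by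
  funext μ α β
  have h := Finset.sum_comm (s := (Finset.univ : Finset (Fin a × Fin n × Fin n)))
    (t := (Finset.univ : Finset (Fin a × Fin n × Fin n)))
    (f := fun x y => r.2 μ y.1 * s.2 y.1 x.1 * (r.1 α y.2.1 * s.1 y.2.1 x.2.1) *
      (r.1 β y.2.2 * s.1 y.2.2 x.2.2) * q x.1 x.2.1 x.2.2)
  simp only [Fintype.sum_prod_type] at h
  have e : ∀ ν γ δ, (∑ i, r.2 μ i * s.2 i ν) * (∑ j, r.1 α j * s.1 j γ) *
      (∑ k, r.1 β k * s.1 k δ) * q ν γ δ = ∑ i, ∑ j, ∑ k, r.2 μ i * s.2 i ν *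
        (r.1 α j * s.1 j γ) * (r.1 β k * s.1 k δ) * q ν γ δ := by
    intro ν γ δ
    simp_rw [Finset.sum_mul_sum, Finset.sum_mul]
    exact Finset.sum_congr rfl fun _ _ => Finset.sum_comm
  simp only [tensorAct, Prod.fst_mul, Prod.snd_mul, Matrix.mul_apply, e]
  rw [h]
  simp only [Finset.mul_sum]
  refine Finset.sum_congr rfl fun _ _ => Finset.sum_congr rfl fun _ _ =>
    Finset.sum_congr rfl fun _ _ => Finset.sum_congr rfl fun _ _ => Finset.sum_congr rfl fun _ _ =>
    Finset.sum_congr rfl fun _ _ => ?_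
  ring

section

attribute [local instance] Matrix.linftyOpNormedRing Matrix.linftyOpNormedAlgebra

theorem contDiff_tensorAct : ContDiff ℂ 1 fun x : (Matrix (Fin n) (Fin n) ℂ ×
    Matrix (Fin a) (Fin a) ℂ) × (Fin a → Fin n → Fin n → ℂ) => tensorAct x.1 x.2 := by
  have h1 : ∀ i j, ContDiff ℂ 1 fun x : (Matrix (Fin n) (Fin n) ℂ ×
    Matrix (Fin a) (Fin a) ℂ) × (Fin a → Fin n → Fin n → ℂ) => x.1.1 i j := fun i j =>
    (LinearMap.toContinuousLinearMap (Matrix.entryLinearMap ℂ ℂ i j)).contDiff.comp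
      (contDiff_fst.comp contDiff_fst)
  have h2 : ∀ i j, ContDiff ℂ 1 fun x : (Matrix (Fin n) (Fin n) ℂ ×
    Matrix (Fin a) (Fin a) ℂ) × (Fin a → Fin n → Fin n → ℂ) => x.1.2 i j := fun i j =>
    (LinearMap.toContinuousLinearMap (Matrix.entryLinearMap ℂ ℂ i j)).contDiff.comp
      (contDiff_snd.comp contDiff_fst)
  refine contDiff_pi.2 fun μ => contDiff_pi.2 fun α => contDiff_pi.2 fun β => ?_
  refine ContDiff.sum fun ν _ => ContDiff.sum fun γ _ => ContDiff.sum fun δ _ => ?_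
  exact (((h2 _ _).mul (h1 _ _)).mul (h1 _ _)).mul (by fun_prop)

theorem fderiv_tensorAct (q : Fin a → Fin n → Fin n → ℂ)
    (p : Matrix (Fin n) (Fin n) ℂ × Matrix (Fin a) (Fin a) ℂ) (μ : Fin a) (α β : Fin n) :
    fderiv ℂ (fun r => tensorAct r q) 1 p μ α β =
      ∑ ν, p.2 μ ν * q ν α β + ∑ γ, p.1 α γ * q μ γ β + ∑ γ, p.1 β γ * q μ α γ := by
  have hd : DifferentiableAt ℂ (fun r => tensorAct r q)
      (1 : Matrix (Fin n) (Fin n) ℂ × Matrix (Fin a) (Fin a) ℂ) :=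
    ((contDiff_tensorAct.comp (contDiff_prodMk_left q)).differentiable one_ne_zero) _
  have hl : HasDerivAt
      (fun t : ℂ => (1 : Matrix (Fin n) (Fin n) ℂ × Matrix (Fin a) (Fin a) ℂ) + t • p) p 0 :=
    (((hasDerivAt_id (0 : ℂ)).smul_const p).const_add _).congr_deriv (one_smul _ _)
  have h1 := HasFDerivAt.comp_hasDerivAt_of_eq (0 : ℂ) hd.hasFDerivAt hl (by simp)
  have h2 := hasDerivAt_pi.1 (hasDerivAt_pi.1 (hasDerivAt_pi.1 h1 μ) α) β
  have hs : ∀ x y : ℂ, HasDerivAt (fun t : ℂ => x + t * y) y 0 := fun x y =>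
    (((hasDerivAt_id (0 : ℂ)).mul_const y).const_add x).congr_deriv (one_mul _)
  have h3 : HasDerivAt (fun t : ℂ => ∑ ν, ∑ γ, ∑ δ,
      ((1 : Matrix (Fin a) (Fin a) ℂ) μ ν + t * p.2 μ ν) *
      ((1 : Matrix (Fin n) (Fin n) ℂ) α γ + t * p.1 α γ) *
      ((1 : Matrix (Fin n) (Fin n) ℂ) β δ + t * p.1 β δ) * q ν γ δ) _ 0 :=
    HasDerivAt.fun_sum fun ν _ => HasDerivAt.fun_sum fun γ _ => HasDerivAt.fun_sum fun δ _ =>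
      (((hs _ _).mul (hs _ _)).mul (hs _ _)).mul_const _
  refine (h2.unique h3).trans ?_
  simp [Matrix.one_apply, add_mul, Finset.sum_add_distrib]

/-- A curve of coefficients of equivalent tensors in `S²T* ⊗ N` is tangent to the image of the
infinitesimal action of `𝔤𝔩(V)_0`. -/
theorem exists_actII_eq_of_curve (q : Quad n a) {c : ℂ → Fin a → Fin n → Fin n → ℂ}
    {c' : Fin a → Fin n → Fin n → ℂ} (hc : HasStrictDerivAt c c' 0) (hc0 : c 0 = q.coeff)
    (horb : ∀ᶠ t in 𝓝 (0 : ℂ), ∃ (A : Matrix (Fin n) (Fin n) ℂ) (B : Matrix (Fin a) (Fin a) ℂ),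
      IsUnit A ∧ IsUnit B ∧ c t = tensorAct (A, B) q.coeff) :
    ∃ u ∈ glDeg n a 0, actII q u = c' := by
  have h : ∀ᶠ t in 𝓝 (0 : ℂ), ∃ u : (Matrix (Fin n) (Fin n) ℂ × Matrix (Fin a) (Fin a) ℂ)ˣ,
      c t = tensorAct u q.coeff := by
    filter_upwards [horb] with t ⟨A, B, hA, hB, h⟩
    obtain ⟨A, rfl⟩ := hA
    obtain ⟨B, rfl⟩ := hB
    exact ⟨MulEquiv.prodUnits.symm (A, B), h⟩
  obtain ⟨p, rfl⟩ := exists_fderiv_action_eq contDiff_tensorAct tensorAct_one tensorAct_mul q.coeff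
    hc hc0 h
  -- The transpose on `T` and the sign on `N` reconcile the conventions: `tensorAct` uses the rows
  -- of the matrix on `T` and acts covariantly on `N`, while `actII` uses columns and a minus sign.
  refine ⟨Matrix.of fun i j => match i, j with
    | Sum.inr (Sum.inl α), Sum.inr (Sum.inl β) => p.1 β α
    | Sum.inr (Sum.inr μ), Sum.inr (Sum.inr ν) => - p.2 μ ν
    | _, _ => 0, ?_, ?_⟩
  · intro i j h
    rcases i with _ | _ | _ <;> rcases j with _ | _ | _ <;> simp_all [level]
  · funext μ α β
    refine Eq.trans ?_ (fderiv_tensorAct q.coeff p μ α β).symm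
    simp [actII]

end

end TensorAction

end FubiniCubic

namespace FubiniCubic

/-! ### Local equations of the cone and their behaviour along rulings. -/

section LocalEquations

variable {V : Type*} [NormedAddCommGroup V] [NormedSpace ℂ V] {n a : ℕ} {X : Set (ℙ ℂ V)}
  {F : V → Fin a → ℂ} {v : V}

theorem smul_mem_cone_iff {s : ℂ} (hs : s ≠ 0) : s • v ∈ cone X ↔ v ∈ cone X := by
  have key : ∀ {s : ℂ} {v : V}, s ≠ 0 → v ∈ cone X → s • v ∈ cone X := by
    rintro s v hs ⟨hv, h⟩
    refine ⟨smul_ne_zero hs hv, ?_⟩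
    rwa [(Projectivization.mk_eq_mk_iff' ℂ _ _ (smul_ne_zero hs hv) hv).2 ⟨s, rfl⟩]
  refine ⟨fun h => ?_, key hs⟩
  simpa [smul_smul, inv_mul_cancel₀ hs] using key (inv_ne_zero hs) h

/-- Near `v`, the cone over `X` is the zero set of the holomorphic submersion `F`. -/
def IsLocalEq (X : Set (ℙ ℂ V)) (F : V → Fin a → ℂ) (v : V) : Prop :=
  ∀ᶠ u in 𝓝 v, AnalyticAt ℂ F u ∧ Function.Surjective (fderiv ℂ F u) ∧ (u ∈ cone X ↔ F u = 0)

theorem IsAnalyticSubmanifold.exists_isLocalEq (hX : IsAnalyticSubmanifold n a X)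
    (hv : v ∈ cone X) : ∃ F : V → Fin a → ℂ, IsLocalEq X F v := by
  obtain ⟨U, F, hU, hvU, hF, hs, he⟩ := hX.2 v hv
  refine ⟨F, ?_⟩
  filter_upwards [hU.mem_nhds hvU] with u hu
  refine ⟨hF u hu, hs u hu, fun h => ?_, fun h => ?_⟩
  · exact (he.subset ⟨h, hu⟩).2
  · exact (he.superset ⟨hu, h⟩).1

namespace IsLocalEq

theorem eventually (h : IsLocalEq X F v) : ∀ᶠ u in 𝓝 v, IsLocalEq X F u :=
  eventually_eventually_nhds.2 h

theorem analyticAt (h : IsLocalEq X F v) : AnalyticAt ℂ F v := h.self_of_nhds.1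

theorem surjective (h : IsLocalEq X F v) : Function.Surjective (fderiv ℂ F v) :=
  h.self_of_nhds.2.1

theorem mem_cone_iff (h : IsLocalEq X F v) : v ∈ cone X ↔ F v = 0 := h.self_of_nhds.2.2

/-- The cone is invariant under scaling although `F` need not be homogeneous. Comparing `F` with its
rescalings is what replaces Euler's relation. -/
theorem comp_smul {s : ℂ} (hs : s ≠ 0) (h : IsLocalEq X F (s • v)) :
    IsLocalEq X (fun u => F (s • u)) v := by
  have hc : Tendsto (fun u : V => s • u) (𝓝 v) (𝓝 (s • v)) := (continuous_const_smul s).tendsto v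
  filter_upwards [hc.eventually h] with u ⟨h1, h2, h3⟩
  refine ⟨h1.fun_comp (by fun_prop), ?_, ?_⟩
  · rw [fderiv_comp_smul]
    intro y
    obtain ⟨w, hw⟩ := h2 (s⁻¹ • y)
    exact ⟨w, by simp [hw, smul_smul, mul_inv_cancel₀ hs]⟩
  · rw [← h3, smul_mem_cone_iff hs]

/-- A local equation may be composed with a linear automorphism of the target. -/
theorem clm_comp (h : IsLocalEq X F v) (L : (Fin a → ℂ) ≃L[ℂ] (Fin a → ℂ)) :
    IsLocalEq X (fun u => L (F u)) v := by
  filter_upwards [h] with u ⟨h1, h2, h3⟩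
  refine ⟨(L.toContinuousLinearMap.analyticAt _).fun_comp h1, ?_, ?_⟩
  · have : fderiv ℂ (fun u => L (F u)) u = L.toContinuousLinearMap ∘L fderiv ℂ F u :=
      L.toContinuousLinearMap.hasFDerivAt.comp u h1.differentiableAt.hasFDerivAt |>.fderiv
    rw [this]
    exact L.surjective.comp h2
  · rw [h3, map_eq_zero_iff L L.injective]

theorem fderiv_apply_eq_zero_of_curve (h : IsLocalEq X F v) {c : ℂ → V} {w : V}
    (hc : HasDerivAt c w 0) (hc0 : c 0 = v) (hX : ∀ᶠ t in 𝓝 (0 : ℂ), c t ∈ cone X) :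
    fderiv ℂ F v w = 0 := by
  have h1 := HasFDerivAt.comp_hasDerivAt_of_eq (0 : ℂ)
    h.analyticAt.differentiableAt.hasFDerivAt hc hc0.symm
  have h2 : F ∘ c =ᶠ[𝓝 0] fun _ => 0 := by
    have ht : Tendsto c (𝓝 0) (𝓝 v) := hc0 ▸ hc.continuousAt.tendsto
    filter_upwards [hX, ht.eventually h] with t h1 h2
    exact h2.2.2.1 h1
  rw [← h1.deriv, h2.deriv_eq, deriv_const]

theorem fderiv_self (h : IsLocalEq X F v) (hv : v ∈ cone X) : fderiv ℂ F v v = 0 := by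
  have hc : HasDerivAt (fun t : ℂ => (1 + t) • v) v 0 :=
    (((hasDerivAt_id (0 : ℂ)).const_add 1).smul_const v).congr_deriv (one_smul _ _)
  refine h.fderiv_apply_eq_zero_of_curve hc (by simp) ?_
  have ht : Tendsto (fun t : ℂ => 1 + t) (𝓝 0) (𝓝 1) := by
    have : Continuous (fun t : ℂ => 1 + t) := by fun_prop
    simpa using this.tendsto 0
  filter_upwards [ht.eventually_ne one_ne_zero] with t ht
  exact (smul_mem_cone_iff ht).2 hv

theorem hasDerivAt_fderiv_smul (h : IsLocalEq X F v) (w : V) :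
    HasDerivAt (fun s : ℂ => fderiv ℂ F (s • v) w) (fderiv ℂ (fderiv ℂ F) v v w) 1 := by
  have hl : HasDerivAt (fun s : ℂ => s • v) v 1 :=
    ((hasDerivAt_id (1 : ℂ)).smul_const v).congr_deriv (one_smul _ _)
  have h1 := HasFDerivAt.comp_hasDerivAt_of_eq (1 : ℂ)
    h.analyticAt.fderiv.differentiableAt.hasFDerivAt hl (one_smul _ _).symm
  exact (h1.clm_apply (hasDerivAt_const 1 w)).congr_deriv (by simp)

theorem fderiv_fderiv_symm (h : IsLocalEq X F v) (x y : V) :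
    fderiv ℂ (fderiv ℂ F) v x y = fderiv ℂ (fderiv ℂ F) v y x :=
  (h.analyticAt.contDiffAt (n := 2)).isSymmSndFDerivAt (by simp) x y

theorem third_symm_right (h : IsLocalEq X F v) (x y z : V) :
    fderiv ℂ (fderiv ℂ (fderiv ℂ F)) v x y z = fderiv ℂ (fderiv ℂ (fderiv ℂ F)) v x z y := by
  have hd := h.analyticAt.fderiv.fderiv.differentiableAt.hasFDerivAt
  have h1 := (hd.clm_apply (hasFDerivAt_const y v)).clm_apply (hasFDerivAt_const z v)
  have h2 := (hd.clm_apply (hasFDerivAt_const z v)).clm_apply (hasFDerivAt_const y v)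
  have h3 : (fun u => fderiv ℂ (fderiv ℂ F) u y z) =ᶠ[𝓝 v]
      fun u => fderiv ℂ (fderiv ℂ F) u z y :=
    h.eventually.mono fun u hu => hu.fderiv_fderiv_symm y z
  have := DFunLike.congr_fun (h1.unique (h2.congr_of_eventuallyEq h3)) x
  simpa using this

theorem third_symm_left (h : IsLocalEq X F v) (x y z : V) :
    fderiv ℂ (fderiv ℂ (fderiv ℂ F)) v x y z = fderiv ℂ (fderiv ℂ (fderiv ℂ F)) v y x z := by
  have := (h.analyticAt.fderiv.contDiffAt (n := 2)).isSymmSndFDerivAt (by simp) x y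
  rw [this]

variable [FiniteDimensional ℂ V]

/-- A holomorphic parametrization of the cone by its tangent space. -/
theorem exists_parametrization (h : IsLocalEq X F v) (hv : v ∈ cone X) :
    ∃ Φ : LinearMap.ker (fderiv ℂ F v).toLinearMap → V, AnalyticAt ℂ Φ 0 ∧ Φ 0 = v ∧
      fderiv ℂ Φ 0 = (LinearMap.ker (fderiv ℂ F v).toLinearMap).subtypeL ∧
      ∀ᶠ s in 𝓝 0, F (Φ s) = 0 := by
  have := FiniteDimensional.complete ℂ V
  set D := fderiv ℂ F v
  set K := LinearMap.ker D.toLinearMap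
  obtain ⟨p', hp'⟩ := K.subtype.exists_leftInverse_of_injective K.ker_subtype
  let p : V →L[ℂ] K := LinearMap.toContinuousLinearMap p'
  have hp : ∀ x : K, p x = x := fun x => LinearMap.congr_fun hp' x
  have hinj : LinearMap.ker (D.prod p).toLinearMap = ⊥ := by
    rw [LinearMap.ker_eq_bot']
    intro u hu
    have h1 : D u = 0 := congrArg Prod.fst hu
    have h2 : p u = 0 := congrArg Prod.snd hu
    have h3 := hp ⟨u, h1⟩
    exact (congrArg Subtype.val (h3.symm.trans h2) : _)
  have hsurj : LinearMap.range (D.prod p).toLinearMap = ⊤ := by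
    rw [eq_top_iff]
    rintro ⟨y, k⟩ -
    obtain ⟨u, hu⟩ := h.surjective y
    refine ⟨u - p u + k, Prod.ext ?_ ?_⟩
    · have h1 : D (p u : V) = 0 := (p u).2
      have h2 : D (k : V) = 0 := k.2
      change D (u - p u + k) = y
      rw [map_add, map_sub, h1, h2, sub_zero, add_zero]
      exact hu
    · change p (u - p u + k) = k
      rw [map_add, map_sub, hp, hp, sub_self, zero_add]
  -- Completing `DF` by a projection `p` onto its kernel gives an isomorphism, so the inverse
  -- function theorem applies to `u ↦ (F u, p (u - v))`. The parametrization is the inverse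
  -- restricted to the slice with first component 0.
  let e : V ≃L[ℂ] (Fin a → ℂ) × K := ContinuousLinearEquiv.ofBijective (D.prod p) hinj hsurj
  let H : V → (Fin a → ℂ) × K := fun u => (F u, p (u - v))
  have hHa : AnalyticAt ℂ H v := by
    refine h.analyticAt.prod ?_
    exact (p.analyticAt _).fun_comp (by fun_prop)
  have hH : HasStrictFDerivAt H (e : V →L[ℂ] (Fin a → ℂ) × K) v :=
    h.analyticAt.hasStrictFDerivAt.prodMk
      (p.hasStrictFDerivAt.comp v ((hasStrictFDerivAt_id v).sub_const v))
  have hHv : H v = (0, 0) := by simp [H, h.mem_cone_iff.1 hv]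
  let G := hH.localInverse H e v
  have hGd : HasFDerivAt G (e.symm : (Fin a → ℂ) × K →L[ℂ] V) (0, 0) :=
    hHv ▸ hH.to_localInverse.hasFDerivAt
  have hGa : AnalyticAt ℂ G (0, 0) := by
    have hsrc := hH.mem_toOpenPartialHomeomorph_source
    have := (hH.toOpenPartialHomeomorph H).analyticAt_symm' hsrc hHa (i := e) hH.hasFDerivAt.fderiv
    exact hHv ▸ this
  have hGr : ∀ᶠ y in 𝓝 (0, 0), H (G y) = y := hHv ▸ hH.eventually_right_inverse
  have hG0 : G (0, 0) = v := by
    rw [← hHv]; exact hH.localInverse_apply_image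
  have hi : HasFDerivAt (fun s : K => ((0 : Fin a → ℂ), s)) (ContinuousLinearMap.inr ℂ _ K) 0 :=
    hasFDerivAt_prodMk_right _ _
  refine ⟨fun s => G (0, s), ?_, hG0, ?_, ?_⟩
  · exact AnalyticAt.fun_comp (f := fun s : K => ((0 : Fin a → ℂ), s)) hGa (by fun_prop)
  · refine (HasFDerivAt.comp (0 : K) (f := fun s : K => ((0 : Fin a → ℂ), s)) hGd hi).fderiv.trans
      (ContinuousLinearMap.ext fun s => ?_)
    change e.symm (0, s) = s
    rw [ContinuousLinearEquiv.symm_apply_eq]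
    exact Prod.ext (show (0 : Fin a → ℂ) = D s from s.2.symm) (hp s).symm
  · have hc : Tendsto (fun s : K => ((0 : Fin a → ℂ), s)) (𝓝 0) (𝓝 (0, 0)) :=
      hi.continuousAt.tendsto
    filter_upwards [hc.eventually hGr] with s hs
    exact congrArg Prod.fst hs

theorem affTangent_eq_ker (h : IsLocalEq X F v) (hv : v ∈ cone X) :
    affTangent X v = LinearMap.ker (fderiv ℂ F v).toLinearMap := by
  apply le_antisymm
  · refine Submodule.span_le.2 ?_
    rintro w ⟨c, hc, hc0, hX, rfl⟩
    exact h.fderiv_apply_eq_zero_of_curve hc.differentiableAt.hasDerivAt hc0 hX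
  · intro w hw
    obtain ⟨Φ, hΦ, hΦ0, hΦd, hΦF⟩ := h.exists_parametrization hv
    have hl : HasDerivAt (fun t : ℂ => t • (⟨w, hw⟩ : LinearMap.ker (fderiv ℂ F v).toLinearMap))
        ⟨w, hw⟩ 0 :=
      ((hasDerivAt_id (0 : ℂ)).smul_const _).congr_deriv (one_smul _ _)
    have hla : AnalyticAt ℂ (fun t : ℂ => t • (⟨w, hw⟩ : LinearMap.ker (fderiv ℂ F v).toLinearMap))
        0 := by fun_prop
    refine Submodule.subset_span ⟨fun t => Φ (t • ⟨w, hw⟩), ?_, by simpa using hΦ0, ?_, ?_⟩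
    · exact AnalyticAt.fun_comp_of_eq hΦ hla (by simp)
    · have ht : Tendsto (fun t : ℂ => t • (⟨w, hw⟩ : LinearMap.ker (fderiv ℂ F v).toLinearMap))
          (𝓝 0) (𝓝 0) := by simpa using hl.continuousAt.tendsto
      have ht' : Tendsto Φ (𝓝 0) (𝓝 v) := by
        have := hΦ.continuousAt.tendsto
        rwa [hΦ0] at this
      filter_upwards [ht.eventually hΦF, (ht'.comp ht).eventually h] with t h1 h2
      exact h2.2.2.2 h1
    · have := HasFDerivAt.comp_hasDerivAt_of_eq (0 : ℂ) hΦ.differentiableAt.hasFDerivAt hl (by simp)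
      rw [hΦd] at this
      exact this.deriv

end IsLocalEq

variable [FiniteDimensional ℂ V]

namespace IsLocalEq

/-- The tangent spaces of the cone are constant along its rulings. -/
theorem eventually_fderiv_smul (h : IsLocalEq X F v) (hv : v ∈ cone X) :
    ∀ᶠ s in 𝓝 (1 : ℂ), ∀ w, fderiv ℂ F v w = 0 → fderiv ℂ F (s • v) w = 0 := by
  have ht : Tendsto (fun s : ℂ => s • v) (𝓝 1) (𝓝 v) := by
    have : Continuous (fun s : ℂ => s • v) := by fun_prop
    simpa using this.tendsto 1
  filter_upwards [ht.eventually h.eventually, eventually_ne_nhds one_ne_zero] with s h1 h2 w hw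
  have e1 := h1.affTangent_eq_ker ((smul_mem_cone_iff h2).2 hv)
  -- The same intrinsic tangent space at `v` is the kernel of the derivative of `F` and of its
  -- rescaling by `s`.
  have e2 := (h1.comp_smul h2).affTangent_eq_ker hv
  have e3 := h.affTangent_eq_ker hv
  have hw' : w ∈ LinearMap.ker (fderiv ℂ F v).toLinearMap := hw
  rw [← e3, e2, LinearMap.mem_ker] at hw'
  have hw'' : fderiv ℂ (fun u => F (s • u)) v w = 0 := hw'
  rw [fderiv_comp_smul] at hw''
  exact (smul_eq_zero.1 hw'').resolve_left h2

/-- Differentiate `DF(s v)(w) = 0` in `s` at `s = 1`: the radial direction lies in the kernel of the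
second fundamental form. -/
theorem fderiv_fderiv_self (h : IsLocalEq X F v) (hv : v ∈ cone X) {w : V}
    (hw : fderiv ℂ F v w = 0) : fderiv ℂ (fderiv ℂ F) v v w = 0 := by
  have h1 := h.hasDerivAt_fderiv_smul w
  have h2 : (fun s : ℂ => fderiv ℂ F (s • v) w) =ᶠ[𝓝 1] fun _ => 0 :=
    (h.eventually_fderiv_smul hv).mono fun s hs => hs w hw
  rw [← h1.deriv, h2.deriv_eq, deriv_const]

end IsLocalEq

end LocalEquations

end FubiniCubic

namespace FubiniCubic

/-! ### Adapted frames and the second fundamental form. -/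

section Frames

variable {V : Type*} [NormedAddCommGroup V] [NormedSpace ℂ V] {n a : ℕ} {X : Set (ℙ ℂ V)}
  {F : V → Fin a → ℂ} {f : Frame V n a}

theorem Frame.expand (f : Frame V n a) (v : V) :
    v = f.repr v iL • f iL + ∑ α, f.repr v (iT α) • f (iT α) + ∑ μ, f.repr v (iN μ) • f (iN μ) := by
  have h := f.sum_repr v
  rw [Fintype.sum_sum_type, Fintype.sum_sum_type] at h
  simpa [add_assoc] using h.symm

theorem Frame.map_expand {E : Type*} [AddCommGroup E] [Module ℂ E] (f : Frame V n a)
    (D : V →ₗ[ℂ] E) (v : V) :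
    D v = f.repr v iL • D (f iL) + ∑ α, f.repr v (iT α) • D (f (iT α)) +
      ∑ μ, f.repr v (iN μ) • D (f (iN μ)) := by
  conv_lhs => rw [f.expand v]
  simp

/-- The map `ℂ^a → ℂ^a` induced by a linear map on the normal vectors of a frame. -/
def normalMap (D : V →L[ℂ] (Fin a → ℂ)) (f : Frame V n a) : (Fin a → ℂ) →L[ℂ] (Fin a → ℂ) :=
  ∑ μ, (ContinuousLinearMap.proj (R := ℂ) (φ := fun _ : Fin a => ℂ) μ).smulRight (D (f (iN μ)))

theorem normalMap_apply (D : V →L[ℂ] (Fin a → ℂ)) (f : Frame V n a) (y : Fin a → ℂ) :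
    normalMap D f y = ∑ μ, y μ • D (f (iN μ)) := by
  simp [normalMap]

/-- A map that kills `e_0` and the `e_α` sees only the normal components of a vector. With `D =
DF(e_0)` surjective, `normalMap` is then the induced isomorphism of the normal space with `ℂ^a`. -/
theorem apply_eq_normalMap {D : V →L[ℂ] (Fin a → ℂ)} (h0 : D (f iL) = 0)
    (hT : ∀ α, D (f (iT α)) = 0) (v : V) : D v = normalMap D f fun μ => f.repr v (iN μ) := by
  rw [normalMap_apply]
  have := f.map_expand D.toLinearMap v
  simpa [h0, hT] using this

theorem isUnit_normalMap {D : V →L[ℂ] (Fin a → ℂ)} (hD : Function.Surjective D)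
    (h0 : D (f iL) = 0) (hT : ∀ α, D (f (iT α)) = 0) : IsUnit (normalMap D f) := by
  have hs : Function.Surjective (normalMap D f) := fun w => by
    obtain ⟨v, rfl⟩ := hD w
    exact ⟨_, (apply_eq_normalMap h0 hT v).symm⟩
  have hi : Function.Injective (normalMap D f) :=
    LinearMap.injective_iff_surjective (f := (normalMap D f).toLinearMap) |>.2 hs
  rw [ContinuousLinearMap.isUnit_iff_bijective]
  exact ⟨hi, hs⟩

theorem normalMap_injective {D : V →L[ℂ] (Fin a → ℂ)} (hD : Function.Surjective D)
    (h0 : D (f iL) = 0) (hT : ∀ α, D (f (iT α)) = 0) : Function.Injective (normalMap D f) :=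
  (ContinuousLinearMap.isUnit_iff_bijective.1 (isUnit_normalMap hD h0 hT)).1

theorem IsAdapted.mem_cone (hf : IsAdapted X f) : f iL ∈ cone X := ⟨f.ne_zero iL, hf.1⟩

theorem IsAdapted.mem_affTangent (hf : IsAdapted X f) (α : Fin n) :
    f (iT α) ∈ affTangent X (f iL) :=
  hf.2 ▸ Submodule.subset_span (Set.mem_insert_of_mem _ ⟨α, rfl⟩)

variable [FiniteDimensional ℂ V]

/-- This turns adaptedness into equations that can be differentiated along a curve of frames. For
the converse, injectivity of `normalMap` makes a vector in the kernel of `DF` have no normal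
components. -/
theorem IsLocalEq.isAdapted_iff (h : IsLocalEq X F (f iL)) :
    IsAdapted X f ↔ f iL ∈ cone X ∧ ∀ α, fderiv ℂ F (f iL) (f (iT α)) = 0 := by
  constructor
  · intro hf
    refine ⟨hf.mem_cone, fun α => ?_⟩
    have := hf.mem_affTangent α
    rwa [h.affTangent_eq_ker hf.mem_cone] at this
  · rintro ⟨hv, hT⟩
    refine ⟨hv.2, ?_⟩
    have h0 := h.fderiv_self hv
    rw [h.affTangent_eq_ker hv]
    apply le_antisymm
    · rw [Submodule.span_le, Set.insert_subset_iff]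
      refine ⟨h0, ?_⟩
      rintro _ ⟨α, rfl⟩
      exact hT α
    · intro u hu
      have hu : fderiv ℂ F (f iL) u = 0 := hu
      rw [apply_eq_normalMap h0 hT] at hu
      have hz := normalMap_injective h.surjective h0 hT (hu.trans (map_zero _).symm)
      rw [f.expand u]
      refine add_mem (add_mem ?_ ?_) ?_
      · exact Submodule.smul_mem _ _ (Submodule.subset_span (Set.mem_insert _ _))
      · exact Submodule.sum_mem _ fun α _ => Submodule.smul_mem _ _
          (Submodule.subset_span (Set.mem_insert_of_mem _ ⟨α, rfl⟩))
      · refine Submodule.sum_mem _ fun μ _ => ?_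
        have := congrFun hz μ
        simp only [Pi.zero_apply] at this
        rw [this, zero_smul]
        exact zero_mem _

/-- There are adapted curves of frames with every given semi-basic velocity. -/
theorem IsLocalEq.exists_isAdaptedCurve (h : IsLocalEq X F (f iL)) (hf : IsAdapted X f)
    (w : Fin n → ℂ) :
    ∃ G : ℂ → Frame V n a, IsAdaptedCurve X G ∧ G 0 = f ∧
      ∀ γ, maurerCartan G (iT γ) iL = w γ := by
  have := FiniteDimensional.complete ℂ V
  obtain ⟨hv, hT⟩ := h.isAdapted_iff.1 hf
  set K := LinearMap.ker (fderiv ℂ F (f iL)).toLinearMap with hK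
  obtain ⟨Φ, hΦ, hΦ0, hΦd, hΦF⟩ := h.exists_parametrization hv
  let e : Fin n → K := fun α => ⟨f (iT α), hT α⟩
  let κ : K := ∑ β, w β • e β
  -- `e_0` runs along the parametrized cone, the `e_α` are the images under `dΦ` of the tangent
  -- vectors at the start, and the normal vectors stay constant.
  let E : ℂ → Idx n a → V := fun t i => match i with
    | Sum.inl _ => Φ (t • κ)
    | Sum.inr (Sum.inl α) => fderiv ℂ Φ (t • κ) (e α)
    | Sum.inr (Sum.inr μ) => f (iN μ)
  have hla : AnalyticAt ℂ (fun t : ℂ => t • κ) 0 := by fun_prop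
  have hlt : Tendsto (fun t : ℂ => t • κ) (𝓝 0) (𝓝 0) := by
    have := hla.continuousAt.tendsto
    rwa [zero_smul] at this
  have hEa : ∀ i, AnalyticAt ℂ (fun t => E t i) 0 := by
    rintro (_ | α | μ)
    · exact AnalyticAt.fun_comp_of_eq hΦ hla (zero_smul _ _)
    · have h1 : AnalyticAt ℂ (fun t : ℂ => fderiv ℂ Φ (t • κ)) 0 :=
        AnalyticAt.fun_comp_of_eq hΦ.fderiv hla (zero_smul _ _)
      exact ((ContinuousLinearMap.apply ℂ V (e α)).analyticAt _).fun_comp h1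
    · exact analyticAt_const
  have hE0 : E 0 = f := by
    funext i
    rcases i with _ | α | μ
    · simpa [E] using hΦ0
    · simp only [E, zero_smul, hΦd]
      rfl
    · rfl
  have hLI : ∀ᶠ t in 𝓝 (0 : ℂ), LinearIndependent ℂ (E t) := by
    have hc : ContinuousAt E 0 := continuousAt_pi.2 fun i => (hEa i).continuousAt
    have ho : IsOpen {x : Idx n a → V | LinearIndependent ℂ x} := isOpen_setOfPred_linearIndependent
    exact hc.eventually (ho.mem_nhds (by rw [hE0]; exact f.linearIndependent))
  have hcard : Fintype.card (Idx n a) = Module.finrank ℂ V :=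
    (Module.finrank_eq_card_basis f).symm
  classical
  -- Linear independence is an open condition, so the default value `f` is not used near `t = 0`.
  let G : ℂ → Frame V n a := fun t =>
    if hl : LinearIndependent ℂ (E t) then basisOfLinearIndependentOfCardEqFinrank hl hcard else f
  have hG : ∀ t, LinearIndependent ℂ (E t) → ∀ i, G t i = E t i := by
    intro t ht i
    simp only [G, dif_pos ht, coe_basisOfLinearIndependentOfCardEqFinrank]
  have hG' : ∀ i, (fun t => G t i) =ᶠ[𝓝 0] fun t => E t i := fun i =>
    hLI.mono fun t ht => hG t ht i
  have hG0 : G 0 = f := by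
    refine Module.Basis.eq_of_apply_eq fun i => ?_
    rw [hG 0 hLI.self_of_nhds, hE0]
  refine ⟨G, ⟨fun i => (hEa i).congr (hG' i).symm, ?_⟩, hG0, fun γ => ?_⟩
  · have ht' : Tendsto (fun t : ℂ => Φ (t • κ)) (𝓝 0) (𝓝 (f iL)) := by
      have := (hEa iL).continuousAt.tendsto
      rwa [hE0] at this
    have hd : ∀ᶠ s in 𝓝 (0 : K), DifferentiableAt ℂ Φ s :=
      hΦ.eventually_analyticAt.mono fun s hs => hs.differentiableAt
    filter_upwards [hLI, ht'.eventually h.eventually, hlt.eventually hΦF.eventually_nhds,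
      hlt.eventually hd] with t h1 h2 h3 h4
    have e0 : G t iL = Φ (t • κ) := hG t h1 iL
    have e1 : ∀ α, G t (iT α) = fderiv ℂ Φ (t • κ) (e α) := fun α => hG t h1 (iT α)
    rw [← e0] at h2
    refine h2.isAdapted_iff.2 ⟨?_, fun α => ?_⟩
    · rw [h2.mem_cone_iff, e0]
      exact h3.self_of_nhds
    · have hF := h2.analyticAt.differentiableAt.hasFDerivAt
      rw [e0] at hF
      have hc := HasFDerivAt.comp (g := F) (f := Φ) (t • κ) hF h4.hasFDerivAt
      have hz : F ∘ Φ =ᶠ[𝓝 (t • κ)] fun _ => 0 := h3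
      have hz' := (hasFDerivAt_const (𝕜 := ℂ) (0 : Fin a → ℂ) (t • κ)).congr_of_eventuallyEq hz
      have := DFunLike.congr_fun (hc.unique hz') (e α)
      rw [e1, e0]
      exact this
  · have hl : HasDerivAt (fun t : ℂ => t • κ) κ 0 :=
      ((hasDerivAt_id (0 : ℂ)).smul_const κ).congr_deriv (one_smul _ _)
    have hd := HasFDerivAt.comp_hasDerivAt_of_eq (0 : ℂ) hΦ.differentiableAt.hasFDerivAt hl
      (zero_smul _ _).symm
    rw [hΦd] at hd
    have hd' : deriv (fun t => G t iL) 0 = κ := by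
      rw [(hG' iL).deriv_eq]
      exact hd.deriv
    have hκ : (κ : V) = ∑ β, w β • f (iT β) := by
      simp [κ, e]
    rw [maurerCartan, Matrix.of_apply, hG0, hd', hκ]
    simp [Finsupp.single_apply]

/-- The equation which determines the coefficients of the second fundamental form from a local
equation. -/
def HasSFF (F : V → Fin a → ℂ) (f : Frame V n a) (q : Quad n a) : Prop :=
  ∀ α β, normalMap (fderiv ℂ F (f iL)) f (fun μ => q.coeff μ α β) =
    - fderiv ℂ (fderiv ℂ F) (f iL) (f (iT β)) (f (iT α))

theorem IsLocalEq.exists_hasSFF (h : IsLocalEq X F (f iL)) (hf : IsAdapted X f) :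
    ∃ q, HasSFF F f q := by
  obtain ⟨hv, hT⟩ := h.isAdapted_iff.1 hf
  have hb := ContinuousLinearMap.isUnit_iff_bijective.1
    (isUnit_normalMap h.surjective (h.fderiv_self hv) hT)
  choose y hy using fun α β => hb.2 (- fderiv ℂ (fderiv ℂ F) (f iL) (f (iT β)) (f (iT α)))
  refine ⟨⟨fun μ α β => y α β μ, fun μ α β => ?_⟩, hy⟩
  refine congrFun (hb.1 ?_) μ
  rw [hy, hy, h.fderiv_fderiv_symm]

/-- Differentiating `DF(e_0)(e_α) = 0` gives `DF(e_α') = -D²F(e_0', e_α)`. Since `e_0'` is tangent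
to the cone and its `e_0` component contributes nothing, only the `ω^β_0` remain on the right; the
left side reads off `ω^μ_α`. -/
theorem IsLocalEq.hasSFF_isSecondFF (h : IsLocalEq X F (f iL)) (hf : IsAdapted X f) {q : Quad n a}
    (hq : HasSFF F f q) : IsSecondFF X f q := by
  intro G hG hG0 μ α
  subst hG0
  obtain ⟨hv, hT⟩ := h.isAdapted_iff.1 hf
  have h0 := h.fderiv_self hv
  have ha := hG.1
  have hd : ∀ i, HasDerivAt (fun t => G t i) (deriv (fun t => G t i) 0) 0 := fun i =>
    (ha i).differentiableAt.hasDerivAt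
  have ht : Tendsto (fun t => G t iL) (𝓝 0) (𝓝 (G 0 iL)) := (ha iL).continuousAt.tendsto
  have hw0 : fderiv ℂ F (G 0 iL) (deriv (fun t => G t iL) 0) = 0 :=
    h.fderiv_apply_eq_zero_of_curve (hd iL) rfl (hG.2.mono fun t ht => ht.mem_cone)
  have hF2 := HasFDerivAt.comp_hasDerivAt (0 : ℂ)
    h.analyticAt.fderiv.differentiableAt.hasFDerivAt (hd iL)
  have h1 := hF2.clm_apply (hd (iT α))
  have h2 : (fun t => fderiv ℂ F (G t iL) (G t (iT α))) =ᶠ[𝓝 0] fun _ => 0 := by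
    filter_upwards [hG.2, ht.eventually h.eventually] with t h1 h2
    exact (h2.isAdapted_iff.1 h1).2 α
  have h3 := h1.unique ((hasDerivAt_const (0 : ℂ) (0 : Fin a → ℂ)).congr_of_eventuallyEq h2)
  set D2 := fderiv ℂ (fderiv ℂ F) (G 0 iL)
  have hN : (fun μ => (G 0).repr (deriv (fun t => G t iL) 0) (iN μ)) = 0 := by
    rw [apply_eq_normalMap h0 hT] at hw0
    exact normalMap_injective h.surjective h0 hT (hw0.trans (map_zero _).symm)
  have h4 : D2 (deriv (fun t => G t iL) 0) (G 0 (iT α)) =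
      - normalMap (fderiv ℂ F (G 0 iL)) (G 0)
        (fun μ => ∑ β, q.coeff μ α β * maurerCartan G (iT β) iL) := by
    have e1 := (G 0).map_expand (D2.flip (G 0 (iT α))).toLinearMap (deriv (fun t => G t iL) 0)
    have e2 : D2 (G 0 iL) (G 0 (iT α)) = 0 := h.fderiv_fderiv_self hv (hT α)
    have e3 : ∀ μ, (G 0).repr (deriv (fun t => G t iL) 0) (iN μ) = 0 := fun μ => congrFun hN μ
    have e4 : ∀ β, D2 (G 0 (iT β)) (G 0 (iT α)) =
      -normalMap (fderiv ℂ F (G 0 iL)) (G 0) (fun μ => q.coeff μ α β) := fun β => by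
        rw [hq, neg_neg]
    simp only [ContinuousLinearMap.coe_coe, ContinuousLinearMap.flip_apply, e2, e3, e4, smul_zero,
      zero_smul, Finset.sum_const_zero, zero_add, add_zero] at e1
    rw [e1]
    simp only [smul_neg, Finset.sum_neg_distrib, ← map_smul, ← map_sum]
    congr 2
    funext μ
    simp [maurerCartan, mul_comm]
  have h5 : fderiv ℂ F (G 0 iL) (deriv (fun t => G t (iT α)) 0) =
      normalMap (fderiv ℂ F (G 0 iL)) (G 0) (fun μ => maurerCartan G (iN μ) (iT α)) :=
    apply_eq_normalMap h0 hT _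
  have h6 := h3
  rw [h4, Function.comp_apply, h5, neg_add_eq_zero] at h6
  exact (congrFun (normalMap_injective h.surjective h0 hT h6) μ).symm

/-- Curves whose semi-basic velocity is a single basis vector isolate each coefficient. -/
theorem IsLocalEq.isSecondFF_unique (h : IsLocalEq X F (f iL)) (hf : IsAdapted X f)
    {q q' : Quad n a} (hq : IsSecondFF X f q) (hq' : IsSecondFF X f q') : q = q' := by
  have : q.coeff = q'.coeff := by
    funext μ α β
    obtain ⟨G, hG, hG0, hw⟩ := h.exists_isAdaptedCurve hf (Pi.single β 1)
    have e := (hq G hG hG0 μ α).symm.trans (hq' G hG hG0 μ α)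
    simpa [hw, Pi.single_apply] using e
  cases q
  cases q'
  simpa using this

theorem IsLocalEq.isSecondFF_iff (h : IsLocalEq X F (f iL)) (hf : IsAdapted X f) {q : Quad n a} :
    IsSecondFF X f q ↔ HasSFF F f q := by
  refine ⟨fun hq => ?_, h.hasSFF_isSecondFF hf⟩
  obtain ⟨q', hq'⟩ := h.exists_hasSFF hf
  rwa [h.isSecondFF_unique hf hq (h.hasSFF_isSecondFF hf hq')]

theorem IsLocalEq.existsUnique_isSecondFF (h : IsLocalEq X F (f iL)) (hf : IsAdapted X f) :
    ∃! q : Quad n a, IsSecondFF X f q := by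
  obtain ⟨q, hq⟩ := h.exists_hasSFF hf
  exact ⟨q, h.hasSFF_isSecondFF hf hq, fun q' hq' =>
    h.isSecondFF_unique hf hq' (h.hasSFF_isSecondFF hf hq)⟩

end Frames

end FubiniCubic

namespace FubiniCubic

/-! ### Normalized equations, third derivatives and analyticity of the coefficients. -/

section Cubics

variable {V : Type*} [NormedAddCommGroup V] [NormedSpace ℂ V] {n a : ℕ} {X : Set (ℙ ℂ V)}
  {F : V → Fin a → ℂ} {f : Frame V n a}

/-- The differential of `F` maps the normal vectors of the frame to the standard basis. -/
def IsNormalized (F : V → Fin a → ℂ) (f : Frame V n a) : Prop :=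
  ∀ μ, fderiv ℂ F (f iL) (f (iN μ)) = Pi.single μ 1

theorem IsNormalized.normalMap_apply (hn : IsNormalized F f) (y : Fin a → ℂ) :
    normalMap (fderiv ℂ F (f iL)) f y = y := by
  rw [FubiniCubic.normalMap_apply]
  funext μ
  simp [hn _, Pi.single_apply]

theorem HasSFF.coeff_eq (hn : IsNormalized F f) {q : Quad n a} (hq : HasSFF F f q) (μ : Fin a)
    (α β : Fin n) :
    q.coeff μ α β = - fderiv ℂ (fderiv ℂ F) (f iL) (f (iT β)) (f (iT α)) μ := by
  have := hq α β
  rw [hn.normalMap_apply] at this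
  exact congrFun this μ

theorem IsLocalEq.fderiv_fderiv_comp_smul (h : IsLocalEq X F v) (s : ℂ) {v' : V} (hv : v = s • v') :
    fderiv ℂ (fderiv ℂ fun u => F (s • u)) v' = s • s • fderiv ℂ (fderiv ℂ F) v := by
  subst hv
  have e : (fderiv ℂ fun u => F (s • u)) = fun u => s • fderiv ℂ F (s • u) := by
    funext u
    exact fderiv_comp_smul s
  have hd : DifferentiableAt ℂ (fun u => fderiv ℂ F (s • u)) v' :=
    DifferentiableAt.comp (g := fderiv ℂ F) (f := fun u => s • u) v'
      h.analyticAt.fderiv.differentiableAt (by fun_prop)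
  rw [e]
  refine (hd.hasFDerivAt.const_smul s).fderiv.trans ?_
  rw [fderiv_comp_smul]

/-- The Fubini cubic form in terms of the derivatives of a normalized local equation. -/
def cubicFormula (F : V → Fin a → ℂ) (f : Frame V n a) (q : Quad n a) : Cubic n a :=
  fun μ α β γ =>
    fderiv ℂ (fderiv ℂ (fderiv ℂ F)) (f iL) (f (iT γ)) (f (iT β)) (f (iT α)) μ +
    ∑ ν, q.coeff ν α β * fderiv ℂ (fderiv ℂ F) (f iL) (f (iT γ)) (f (iN ν)) μ +
    ∑ ν, q.coeff ν α γ * fderiv ℂ (fderiv ℂ F) (f iL) (f (iT β)) (f (iN ν)) μ +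
    ∑ ν, q.coeff ν β γ * fderiv ℂ (fderiv ℂ F) (f iL) (f (iT α)) (f (iN ν)) μ

/-- Exchanging `β` and `γ` swaps the first two sums and preserves the third; the rest is symmetry of
the third derivative. This symmetry will supply the structure equation. -/
theorem IsLocalEq.cubicFormula_symm (h : IsLocalEq X F (f iL)) (q : Quad n a) (μ : Fin a)
    (α β γ : Fin n) : cubicFormula F f q μ α β γ = cubicFormula F f q μ α γ β := by
  simp only [cubicFormula, q.symm _ γ β]
  rw [h.third_symm_left]
  ring

theorem IsAdaptedCurve.hasDerivAt {G : ℂ → Frame V n a} (hG : IsAdaptedCurve X G) (i : Idx n a) :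
    HasDerivAt (fun t => G t i) (deriv (fun t => G t i) 0) 0 :=
  (hG.1 i).differentiableAt.hasDerivAt

theorem analyticAt_clm_apply {E E' : Type*} [NormedAddCommGroup E] [NormedSpace ℂ E]
    [NormedAddCommGroup E'] [NormedSpace ℂ E'] {T : ℂ → E →L[ℂ] E'} {x : ℂ → E} {t : ℂ}
    (hT : AnalyticAt ℂ T t) (hx : AnalyticAt ℂ x t) : AnalyticAt ℂ (fun t => T t (x t)) t :=
  AnalyticAt.comp₂ (h := fun p : (E →L[ℂ] E') × E => p.1 p.2)
    ((ContinuousLinearMap.id ℂ (E →L[ℂ] E')).analyticAt_bilinear _) hT hx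

variable [FiniteDimensional ℂ V]

/-- Composing `F` with the inverse of `normalMap` in the target makes `normalMap` the identity at
`f`, so components of `F` become normal coordinates. -/
theorem IsLocalEq.exists_isNormalized (h : IsLocalEq X F (f iL)) (hf : IsAdapted X f) :
    ∃ F' : V → Fin a → ℂ, IsLocalEq X F' (f iL) ∧ IsNormalized F' f := by
  obtain ⟨hv, hT⟩ := h.isAdapted_iff.1 hf
  obtain ⟨u, hu⟩ := isUnit_normalMap h.surjective (h.fderiv_self hv) hT
  let L : (Fin a → ℂ) ≃L[ℂ] (Fin a → ℂ) := ContinuousLinearEquiv.unitsEquiv ℂ (Fin a → ℂ) u⁻¹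
  refine ⟨fun v => L (F v), h.clm_comp L, fun μ => ?_⟩
  have : fderiv ℂ (fun u => L (F u)) (f iL) = L.toContinuousLinearMap ∘L fderiv ℂ F (f iL) :=
    L.toContinuousLinearMap.hasFDerivAt.comp _ h.analyticAt.differentiableAt.hasFDerivAt |>.fderiv
  rw [this]
  have e : fderiv ℂ F (f iL) (f (iN μ)) = u.1 (Pi.single μ 1) := by
    rw [hu, normalMap_apply, Finset.sum_eq_single μ]
    · simp
    · intro ν _ hν
      rw [Pi.single_eq_of_ne hν, zero_smul]
    · simp
  change (↑u⁻¹ : (Fin a → ℂ) →L[ℂ] (Fin a → ℂ)) (fderiv ℂ F (f iL) (f (iN μ))) = _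
  rw [e]
  exact DFunLike.congr_fun u.inv_mul (Pi.single μ (1 : ℂ))

/-- The behaviour of the third derivative of a local equation along the rulings of the cone. -/
theorem IsLocalEq.third_self (h : IsLocalEq X F (f iL)) (hf : IsAdapted X f) {q : Quad n a}
    (hq : IsSecondFF X f q) (α β : Fin n) :
    fderiv ℂ (fderiv ℂ (fderiv ℂ F)) (f iL) (f iL) (f (iT β)) (f (iT α)) +
      ∑ ν, q.coeff ν α β • fderiv ℂ (fderiv ℂ F) (f iL) (f iL) (f (iN ν)) =
      ∑ ν, q.coeff ν α β • fderiv ℂ F (f iL) (f (iN ν)) := by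
  have hl : HasDerivAt (fun s : ℂ => s • f iL) (f iL) 1 :=
    ((hasDerivAt_id (1 : ℂ)).smul_const (f iL)).congr_deriv (one_smul _ _)
  have ht : Tendsto (fun s : ℂ => s • f iL) (𝓝 1) (𝓝 (f iL)) := by
    have := hl.continuousAt.tendsto
    rwa [one_smul] at this
  -- The coefficients `q` belong to the frame and not to the equation, so the rescaled equation `u ↦
  -- F (s • u)` yields the same `q` for every `s` near 1. Differentiating this identity at `s = 1`
  -- gives the claim.
  have e : (fun s : ℂ => ∑ ν, q.coeff ν α β • (s • fderiv ℂ F (s • f iL) (f (iN ν)))) =ᶠ[𝓝 1]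
      fun s : ℂ => -(s • s • fderiv ℂ (fderiv ℂ F) (s • f iL) (f (iT β)) (f (iT α))) := by
    filter_upwards [ht.eventually h.eventually, eventually_ne_nhds one_ne_zero] with s h1 h2
    have h3 := ((h1.comp_smul h2).isSecondFF_iff hf).1 hq α β
    rw [normalMap_apply, fderiv_comp_smul, h1.fderiv_fderiv_comp_smul s rfl] at h3
    exact h3
  have d1 := HasDerivAt.fun_sum (u := Finset.univ) fun ν (_ : ν ∈ (Finset.univ : Finset (Fin a))) =>
    (((hasDerivAt_id (1 : ℂ)).smul (h.hasDerivAt_fderiv_smul (f (iN ν)))).const_smul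
      (q.coeff ν α β))
  have d0 := HasFDerivAt.comp_hasDerivAt_of_eq (1 : ℂ)
    h.analyticAt.fderiv.fderiv.differentiableAt.hasFDerivAt hl (one_smul _ _).symm
  have d2 := ((hasDerivAt_id (1 : ℂ)).smul ((hasDerivAt_id (1 : ℂ)).smul
    ((d0.clm_apply (hasDerivAt_const (1 : ℂ) (f (iT β)))).clm_apply
      (hasDerivAt_const (1 : ℂ) (f (iT α)))))).neg
  have d3 := d1.unique (d2.congr_of_eventuallyEq e)
  have hq' := (h.isSecondFF_iff hf).1 hq α β
  rw [normalMap_apply] at hq'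
  simp only [id, one_smul, Function.comp_apply, smul_add, Finset.sum_add_distrib, map_zero,
    add_zero] at d3
  have e2 : ((id : ℂ → ℂ) • fun y : ℂ =>
      fderiv ℂ (fderiv ℂ F) (y • f iL) (f (iT β)) (f (iT α))) (1 : ℂ) =
      fderiv ℂ (fderiv ℂ F) (f iL) (f (iT β)) (f (iT α)) := by
    change (1 : ℂ) • fderiv ℂ (fderiv ℂ F) ((1 : ℂ) • f iL) (f (iT β)) (f (iT α)) = _
    rw [one_smul, one_smul]
  rw [e2] at d3
  linear_combination d3 - 2 * hq'

/-- The family `q` is only assumed pointwise, but its values are forced: near 0 they equal the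
inverse of `normalMap` applied to `-D²F(e_β, e_α)`, and inversion is analytic at units. -/
theorem IsLocalEq.analyticAt_coeff (h : IsLocalEq X F (f iL)) {G : ℂ → Frame V n a}
    {q : ℂ → Quad n a} (hG : IsAdaptedCurve X G) (hG0 : G 0 = f)
    (hq : ∀ᶠ t in 𝓝 (0 : ℂ), IsSecondFF X (G t) (q t)) (α β : Fin n) :
    AnalyticAt ℂ (fun t => fun μ => (q t).coeff μ α β) 0 := by
  subst hG0
  have ha := hG.1
  have ht : Tendsto (fun t => G t iL) (𝓝 0) (𝓝 (G 0 iL)) := (ha iL).continuousAt.tendsto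
  obtain ⟨hv, hT⟩ := h.isAdapted_iff.1 hG.2.self_of_nhds
  have hD : AnalyticAt ℂ (fun t => fderiv ℂ F (G t iL)) 0 :=
    AnalyticAt.fun_comp h.analyticAt.fderiv (ha iL)
  have hD2 : AnalyticAt ℂ (fun t => fderiv ℂ (fderiv ℂ F) (G t iL)) 0 :=
    AnalyticAt.fun_comp h.analyticAt.fderiv.fderiv (ha iL)
  have hu : AnalyticAt ℂ (fun t => normalMap (fderiv ℂ F (G t iL)) (G t)) 0 := by
    unfold normalMap
    refine Finset.analyticAt_fun_sum _ fun μ _ => ?_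
    exact ((ContinuousLinearMap.smulRightL ℂ (Fin a → ℂ) (Fin a → ℂ)
      (ContinuousLinearMap.proj μ)).analyticAt _).fun_comp (analyticAt_clm_apply hD (ha (iN μ)))
  obtain ⟨u, hu0⟩ := isUnit_normalMap (f := G 0) h.surjective (h.fderiv_self hv) hT
  have hinv : AnalyticAt ℂ (fun t => Ring.inverse (normalMap (fderiv ℂ F (G t iL)) (G t))) 0 :=
    AnalyticAt.fun_comp_of_eq (analyticAt_inverse u) hu hu0.symm
  have hy : AnalyticAt ℂ (fun t => Ring.inverse (normalMap (fderiv ℂ F (G t iL)) (G t))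
      (-fderiv ℂ (fderiv ℂ F) (G t iL) (G t (iT β)) (G t (iT α)))) 0 :=
    analyticAt_clm_apply hinv
      (analyticAt_clm_apply (analyticAt_clm_apply hD2 (ha (iT β))) (ha (iT α))).neg
  refine hy.congr ?_
  filter_upwards [hq, hG.2, ht.eventually h.eventually] with t h1 h2 h3
  obtain ⟨hv, hT⟩ := h3.isAdapted_iff.1 h2
  have h4 := (h3.isSecondFF_iff h2).1 h1 α β
  obtain ⟨u, hu⟩ := isUnit_normalMap h3.surjective (h3.fderiv_self hv) hT
  rw [← h4, ← hu, Ring.inverse_unit]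
  exact DFunLike.congr_fun u.inv_mul _

theorem IsLocalEq.maurerCartan_iN_iL (h : IsLocalEq X F (f iL)) {G : ℂ → Frame V n a}
    (hG : IsAdaptedCurve X G) (hG0 : G 0 = f) (μ : Fin a) : maurerCartan G (iN μ) iL = 0 := by
  subst hG0
  obtain ⟨hv, hT⟩ := h.isAdapted_iff.1 hG.2.self_of_nhds
  have hw0 : fderiv ℂ F (G 0 iL) (deriv (fun t => G t iL) 0) = 0 :=
    h.fderiv_apply_eq_zero_of_curve (hG.hasDerivAt iL) rfl (hG.2.mono fun t ht => ht.mem_cone)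
  rw [apply_eq_normalMap (h.fderiv_self hv) hT] at hw0
  exact congrFun (normalMap_injective h.surjective (h.fderiv_self hv) hT
    (hw0.trans (map_zero _).symm)) μ

end Cubics

end FubiniCubic

namespace FubiniCubic

/-! ### The Fubini cubic form: explicit formula, existence and uniqueness. -/

section CubicFormula

variable {V : Type*} [NormedAddCommGroup V] [NormedSpace ℂ V] [FiniteDimensional ℂ V] {n a : ℕ}
  {X : Set (ℙ ℂ V)} {F : V → Fin a → ℂ} {f : Frame V n a}

/-- The derivative along a curve of frames of the equation which determines the second fundamental
form. -/
theorem IsLocalEq.deriv_hasSFF (h : IsLocalEq X F (f iL)) (hn : IsNormalized F f)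
    {G : ℂ → Frame V n a} {q : ℂ → Quad n a} (hG : IsAdaptedCurve X G) (hG0 : G 0 = f)
    (hq : ∀ᶠ t in 𝓝 (0 : ℂ), IsSecondFF X (G t) (q t)) (μ : Fin a) (α β : Fin n) :
    deriv (fun t => (q t).coeff μ α β) 0 +
      ∑ ν, (q 0).coeff ν α β *
        (fderiv ℂ (fderiv ℂ F) (f iL) (deriv (fun t => G t iL) 0) (f (iN ν)) μ +
        fderiv ℂ F (f iL) (deriv (fun t => G t (iN ν)) 0) μ) =
    - (fderiv ℂ (fderiv ℂ (fderiv ℂ F)) (f iL) (deriv (fun t => G t iL) 0) (f (iT β)) (f (iT α)) μ +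
      fderiv ℂ (fderiv ℂ F) (f iL) (deriv (fun t => G t (iT β)) 0) (f (iT α)) μ +
      fderiv ℂ (fderiv ℂ F) (f iL) (f (iT β)) (deriv (fun t => G t (iT α)) 0) μ) := by
  have hqa := fun ν => hasDerivAt_pi.1
    (h.analyticAt_coeff hG hG0 hq α β).differentiableAt.hasDerivAt ν
  have hqd : ∀ ν, HasDerivAt (fun t => (q t).coeff ν α β)
    (deriv (fun t => (q t).coeff ν α β) 0) 0 := fun ν => (hqa ν).differentiableAt.hasDerivAt
  subst hG0
  have ht : Tendsto (fun t => G t iL) (𝓝 0) (𝓝 (G 0 iL)) := (hG.1 iL).continuousAt.tendsto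
  have hF2 : HasDerivAt (fun t => fderiv ℂ F (G t iL)) _ 0 := HasFDerivAt.comp_hasDerivAt (0 : ℂ)
    h.analyticAt.fderiv.differentiableAt.hasFDerivAt (hG.hasDerivAt iL)
  have hF3 : HasDerivAt (fun t => fderiv ℂ (fderiv ℂ F) (G t iL)) _ 0 :=
    HasFDerivAt.comp_hasDerivAt (l := fderiv ℂ (fderiv ℂ F)) (0 : ℂ)
      h.analyticAt.fderiv.fderiv.differentiableAt.hasFDerivAt (hG.hasDerivAt iL)
  have d1 := HasDerivAt.fun_sum (u := Finset.univ) fun ν (_ : ν ∈ (Finset.univ : Finset (Fin a))) =>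
    (hqd ν).smul (hF2.clm_apply (hG.hasDerivAt (iN ν)))
  have d2 := ((hF3.clm_apply (hG.hasDerivAt (iT β))).clm_apply (hG.hasDerivAt (iT α))).neg
  have e : (fun t => ∑ ν, (q t).coeff ν α β • fderiv ℂ F (G t iL) (G t (iN ν))) =ᶠ[𝓝 0]
      fun t => - fderiv ℂ (fderiv ℂ F) (G t iL) (G t (iT β)) (G t (iT α)) := by
    filter_upwards [hq, hG.2, ht.eventually h.eventually] with t h1 h2 h3
    have h4 := (h3.isSecondFF_iff h2).1 h1 α β
    rwa [normalMap_apply] at h4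
  have d3 := congrFun (d1.unique (d2.congr_of_eventuallyEq e)) μ
  simp only [hn _] at d3
  simp only [Finset.sum_add_distrib, smul_add, Pi.add_apply, Pi.neg_apply, Finset.sum_apply,
    Pi.smul_apply, smul_eq_mul, Pi.single_apply, mul_ite, mul_one, mul_zero, Finset.sum_ite_eq,
    Finset.mem_univ, if_true, add_apply] at d3
  simp only [mul_add, Finset.sum_add_distrib]
  linear_combination d3

theorem IsLocalEq.isFubiniCubic_cubicFormula (h : IsLocalEq X F (f iL)) (hf : IsAdapted X f)
    (hn : IsNormalized F f) {q : Quad n a} (hq : IsSecondFF X f q) :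
    IsFubiniCubic X f (cubicFormula F f q) := by
  intro G qt hG hG0 hqt μ α β
  have hq0 : qt 0 = q := by
    have := hqt.self_of_nhds
    rw [hG0] at this
    exact h.isSecondFF_unique hf this hq
  have hd := h.deriv_hasSFF hn hG hG0 hqt μ α β
  have heul := congrFun (h.third_self hf hq α β) μ
  have hwN := h.maurerCartan_iN_iL hG hG0
  have hwNT : ∀ ν γ, maurerCartan G (iN ν) (iT γ) =
    ∑ β, q.coeff ν γ β * maurerCartan G (iT β) iL := fun ν γ => hq G hG hG0 ν γ
  obtain ⟨hv, hT⟩ := h.isAdapted_iff.1 hf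
  have hsff := HasSFF.coeff_eq hn ((h.isSecondFF_iff hf).1 hq)
  rw [hq0] at hd ⊢
  have hrep : ∀ i j, f.repr (deriv (fun t => G t j) 0) i = maurerCartan G i j := fun i j => by
    rw [maurerCartan, Matrix.of_apply, hG0]
  set D1 := fderiv ℂ F (f iL)
  set D2 := fderiv ℂ (fderiv ℂ F) (f iL)
  set D3 := fderiv ℂ (fderiv ℂ (fderiv ℂ F)) (f iL)
  have hsymm : ∀ x y, D2 x y = D2 y x := h.fderiv_fderiv_symm
  have hD2T : ∀ γ, D2 (f iL) (f (iT γ)) = 0 := fun γ => h.fderiv_fderiv_self hv (hT γ)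
  have hD2TT : ∀ γ δ, D2 (f (iT γ)) (f (iT δ)) μ = - q.coeff μ δ γ := fun γ δ => by
    rw [hsff, neg_neg]
  -- The velocities of the frame vectors are expanded in the frame itself. The normal component of
  -- `e_0'` vanishes, and the normal components of `e_γ'` are replaced through `II`.
  have e1 : D3 (deriv (fun t => G t iL) 0) (f (iT β)) (f (iT α)) μ =
      maurerCartan G iL iL * D3 (f iL) (f (iT β)) (f (iT α)) μ +
      ∑ γ, maurerCartan G (iT γ) iL * D3 (f (iT γ)) (f (iT β)) (f (iT α)) μ := by
    have := congrFun (f.map_expand ((D3.flip (f (iT β))).flip (f (iT α))).toLinearMap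
      (deriv (fun t => G t iL) 0)) μ
    simpa [hrep, hwN] using this
  have e2 : ∀ ν, D2 (deriv (fun t => G t iL) 0) (f (iN ν)) μ =
      maurerCartan G iL iL * D2 (f iL) (f (iN ν)) μ +
      ∑ γ, maurerCartan G (iT γ) iL * D2 (f (iT γ)) (f (iN ν)) μ := fun ν => by
    have := congrFun (f.map_expand (D2.flip (f (iN ν))).toLinearMap
      (deriv (fun t => G t iL) 0)) μ
    simpa [hrep, hwN] using this
  have e3 : ∀ ν, D1 (deriv (fun t => G t (iN ν)) 0) μ = maurerCartan G (iN μ) (iN ν) := fun ν => by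
    have := congrFun (f.map_expand D1.toLinearMap (deriv (fun t => G t (iN ν)) 0)) μ
    simpa [hrep, hT, h.fderiv_self hv, D1, hn _, Pi.single_apply] using this
  have e4 : ∀ γ δ, D2 (deriv (fun t => G t (iT γ)) 0) (f (iT δ)) μ =
      - ∑ ε, maurerCartan G (iT ε) (iT γ) * q.coeff μ δ ε +
      ∑ ν, (∑ ε, q.coeff ν γ ε * maurerCartan G (iT ε) iL) * D2 (f (iT δ)) (f (iN ν)) μ := by
    intro γ δ
    have := congrFun (f.map_expand (D2.flip (f (iT δ))).toLinearMap
      (deriv (fun t => G t (iT γ)) 0)) μ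
    simp only [ContinuousLinearMap.coe_coe, ContinuousLinearMap.flip_apply, hrep, hD2T, smul_zero,
      zero_add, Pi.add_apply, Finset.sum_apply, Pi.smul_apply, smul_eq_mul, hD2TT, hwNT] at this
    rw [this]
    simp only [mul_neg, Finset.sum_neg_distrib, hsymm _ (f (iT δ))]
  have e5 := hsymm (f (iT β)) (deriv (fun t => G t (iT α)) 0)
  rw [e5, e4, e4, e1] at hd
  simp only [e2, e3] at hd
  simp only [Pi.add_apply, Finset.sum_apply, Pi.smul_apply, smul_eq_mul] at heul
  have hdelta : ∑ ν, q.coeff ν α β * D1 (f (iN ν)) μ = q.coeff μ α β := by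
    simp [D1, hn _, Pi.single_apply]
  rw [hdelta] at heul
  have s1 : ∑ γ, cubicFormula F f q μ α β γ * maurerCartan G (iT γ) iL =
      ∑ γ, maurerCartan G (iT γ) iL * D3 (f (iT γ)) (f (iT β)) (f (iT α)) μ +
      ∑ ν, q.coeff ν α β * ∑ γ, maurerCartan G (iT γ) iL * D2 (f (iT γ)) (f (iN ν)) μ +
      ∑ ν, (∑ ε, q.coeff ν α ε * maurerCartan G (iT ε) iL) * D2 (f (iT β)) (f (iN ν)) μ +
      ∑ ν, (∑ ε, q.coeff ν β ε * maurerCartan G (iT ε) iL) * D2 (f (iT α)) (f (iN ν)) μ := by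
    simp only [cubicFormula, add_mul, Finset.sum_add_distrib, Finset.sum_mul, Finset.mul_sum]
    congr 1
    · congr 1
      · congr 1
        · exact Finset.sum_congr rfl fun _ _ => mul_comm _ _
        · rw [Finset.sum_comm]
          exact Finset.sum_congr rfl fun _ _ => Finset.sum_congr rfl fun _ _ => by
            simp only [D2]; ring
      · rw [Finset.sum_comm]
        exact Finset.sum_congr rfl fun _ _ => Finset.sum_congr rfl fun _ _ => by
            simp only [D2]; ring
    · rw [Finset.sum_comm]
      exact Finset.sum_congr rfl fun _ _ => Finset.sum_congr rfl fun _ _ => by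
            simp only [D2]; ring
  rw [s1]
  have s2 : ∑ ν, q.coeff ν α β * (maurerCartan G iL iL * D2 (f iL) (f (iN ν)) μ) =
      maurerCartan G iL iL * ∑ ν, q.coeff ν α β * D2 (f iL) (f (iN ν)) μ := by
    rw [Finset.mul_sum]
    exact Finset.sum_congr rfl fun _ _ => by ring
  simp only [mul_add, Finset.sum_add_distrib, s2] at hd
  have s3 : ∀ γ δ, ∑ ε, maurerCartan G (iT ε) (iT γ) * q.coeff μ δ ε =
      ∑ ε, q.coeff μ δ ε * maurerCartan G (iT ε) (iT γ) := fun γ δ =>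
    Finset.sum_congr rfl fun _ _ => mul_comm _ _
  rw [s3, s3] at hd
  -- The `ω^0_0` multiples of `D³F(e_0, ·, ·)` and `D²F(e_0, e_ν)` combine, by the relation along
  -- the rulings, into the single term `q^μ_{αβ} ω^0_0` of the definition.
  linear_combination hd - maurerCartan G iL iL * heul

theorem IsLocalEq.exists_isSecondFF_along (h : IsLocalEq X F (f iL)) {G : ℂ → Frame V n a}
    (hG : IsAdaptedCurve X G) (hG0 : G 0 = f) :
    ∃ q : ℂ → Quad n a, ∀ᶠ t in 𝓝 (0 : ℂ), IsSecondFF X (G t) (q t) := by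
  subst hG0
  classical
  -- The zero tensor is only a filler for parameters where no second fundamental form is available;
  -- near 0 it does not occur.
  refine ⟨fun t => if ht : ∃ q, IsSecondFF X (G t) q then ht.choose else ⟨0, fun _ _ _ => rfl⟩, ?_⟩
  have ht : Tendsto (fun t => G t iL) (𝓝 0) (𝓝 (G 0 iL)) := (hG.1 iL).continuousAt.tendsto
  filter_upwards [hG.2, ht.eventually h.eventually] with t h2 h3
  have h4 := (h3.existsUnique_isSecondFF h2).exists
  rw [dif_pos h4]
  exact h4.choose_spec

theorem IsLocalEq.isFubiniCubic_unique (h : IsLocalEq X F (f iL)) (hf : IsAdapted X f)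
    {r r' : Cubic n a} (hr : IsFubiniCubic X f r) (hr' : IsFubiniCubic X f r') : r = r' := by
  funext μ α β γ
  obtain ⟨G, hG, hG0, hw⟩ := h.exists_isAdaptedCurve hf (Pi.single γ 1)
  obtain ⟨q, hq⟩ := h.exists_isSecondFF_along hG hG0
  have e := (hr G q hG hG0 hq μ α β).trans (hr' G q hG hG0 hq μ α β).symm
  simpa [hw, Pi.single_apply] using e

theorem IsLocalEq.isFubiniCubic_iff (h : IsLocalEq X F (f iL)) (hf : IsAdapted X f)
    (hn : IsNormalized F f) {q : Quad n a} (hq : IsSecondFF X f q) {r : Cubic n a} :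
    IsFubiniCubic X f r ↔ r = cubicFormula F f q :=
  ⟨fun hr => h.isFubiniCubic_unique hf hr (h.isFubiniCubic_cubicFormula hf hn hq),
    fun hr => hr ▸ h.isFubiniCubic_cubicFormula hf hn hq⟩

end CubicFormula

end FubiniCubic

namespace FubiniCubic

/-! ### General points: constancy of the orbit and admissibility of the cubic. -/

section GeneralPoint

variable {V : Type*} [NormedAddCommGroup V] [NormedSpace ℂ V] [FiniteDimensional ℂ V] {n a : ℕ}
  {X : Set (ℙ ℂ V)}

/-- The second fundamental forms in two adapted frames over the same point are equivalent. -/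
theorem IsAnalyticSubmanifold.exists_coeff_eq_tensorAct (hX : IsAnalyticSubmanifold n a X)
    {f f' : Frame V n a} (hf : IsAdapted X f) (hf' : IsAdapted X f')
    (hp : Frame.point f' = Frame.point f) {q q' : Quad n a} (hq : IsSecondFF X f q)
    (hq' : IsSecondFF X f' q') :
    ∃ (A : Matrix (Fin n) (Fin n) ℂ) (B : Matrix (Fin a) (Fin a) ℂ), IsUnit A ∧ IsUnit B ∧
      q'.coeff = tensorAct (A, B) q.coeff := by
  obtain ⟨s, hs⟩ := (Projectivization.mk_eq_mk_iff' ℂ _ _ (f'.ne_zero iL) (f.ne_zero iL)).1 hp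
  have hs0 : s ≠ 0 := by
    rintro rfl
    exact f'.ne_zero iL (by rw [← hs, zero_smul])
  obtain ⟨F₀, hF₀⟩ := hX.exists_isLocalEq hf'.mem_cone
  obtain ⟨F, hF, hn⟩ := hF₀.exists_isNormalized hf'
  obtain ⟨hv, hT'⟩ := hF.isAdapted_iff.1 hf'
  -- The first vectors of the two frames differ by the factor `s`. One equation `F` normalized at
  -- `f'` serves both frames, after rescaling for `f`.
  have hFs : IsLocalEq X (fun u => F (s • u)) (f iL) :=
    IsLocalEq.comp_smul hs0 (by rw [hs]; exact hF)
  obtain ⟨hv1, hT1⟩ := hFs.isAdapted_iff.1 hf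
  have hsff := (hFs.isSecondFF_iff hf).1 hq
  have hsff' := HasSFF.coeff_eq hn ((hF.isSecondFF_iff hf').1 hq')
  have hd1 : fderiv ℂ (fun u => F (s • u)) (f iL) = s • fderiv ℂ F (f' iL) := by
    rw [fderiv_comp_smul, hs]
  have hd2 := hF.fderiv_fderiv_comp_smul s hs.symm
  simp only [HasSFF, hd1, hd2, normalMap_apply] at hsff
  have hT : ∀ α, fderiv ℂ F (f' iL) (f (iT α)) = 0 := fun α => by
    have := hT1 α
    rw [hd1] at this
    exact (smul_eq_zero.1 this).resolve_left hs0
  have h0' := hF.fderiv_self hv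
  have hf0 : f iL = s⁻¹ • f' iL := by rw [← hs, smul_smul, inv_mul_cancel₀ hs0, one_smul]
  have h0 : fderiv ℂ F (f' iL) (f iL) = 0 := by rw [hf0, map_smul, h0', smul_zero]
  have hself : ∀ w, fderiv ℂ F (f' iL) w = 0 →
      fderiv ℂ (fderiv ℂ F) (f' iL) (f iL) w = 0 := fun w hw => by
    rw [hf0, map_smul, smul_apply, hF.fderiv_fderiv_self hv hw, smul_zero]
  set D1 := fderiv ℂ F (f' iL)
  set D2 := fderiv ℂ (fderiv ℂ F) (f' iL)
  have hsymm : ∀ x y, D2 x y = D2 y x := hF.fderiv_fderiv_symm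
  have hN : ∀ α μ, f.repr (f' (iT α)) (iN μ) = 0 := fun α μ => by
    have h1 := hT' α
    rw [apply_eq_normalMap h0 hT] at h1
    exact congrFun (normalMap_injective hF.surjective h0 hT (h1.trans (map_zero _).symm)) μ
  have hD2 : ∀ α β μ, D2 (f (iT β)) (f (iT α)) μ =
      - ∑ ν, q.coeff ν α β * (s⁻¹ * D1 (f (iN ν)) μ) := fun α β μ => by
    have h1 := congrFun (hsff α β) μ
    simp only [Finset.sum_apply, Pi.smul_apply, smul_apply, Pi.neg_apply,
      smul_eq_mul] at h1
    have h2 : ∑ ν, q.coeff ν α β * (s⁻¹ * D1 (f (iN ν)) μ) =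
        s⁻¹ * s⁻¹ * ∑ ν, q.coeff ν α β * (s * D1 (f (iN ν)) μ) := by
      rw [Finset.mul_sum]
      refine Finset.sum_congr rfl fun _ _ => ?_
      field_simp
    rw [h2, h1]
    field_simp
  -- `A` expresses the tangent vectors of `f'` in those of `f` modulo `e_0`. `B` expresses the
  -- normal classes of `f` in those of `f'`, with `s⁻¹` accounting for the change of `e_0`.
  refine ⟨Matrix.of fun α γ => f.repr (f' (iT α)) (iT γ),
    Matrix.of fun μ ν => s⁻¹ * D1 (f (iN ν)) μ, ?_, ?_, ?_⟩
  · refine IsUnit.of_mul_eq_one (Matrix.of fun γ δ => f'.repr (f (iT γ)) (iT δ)) ?_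
    ext α δ
    have := f.map_expand (f'.coord (iT δ)) (f' (iT α))
    simp only [hN, hf0, Module.Basis.coord_apply, map_smul, Module.Basis.repr_self, zero_smul,
      Finset.sum_const_zero, add_zero] at this
    rw [Matrix.mul_apply]
    simpa [Finsupp.single_apply, Matrix.one_apply, eq_comm] using this.symm
  · refine IsUnit.of_mul_eq_one (Matrix.of fun ν μ => s * f.repr (f' (iN μ)) (iN ν)) ?_
    ext μ μ'
    have := congrFun (f.map_expand D1.toLinearMap (f' (iN μ'))) μ
    have hn' : D1 (f' (iN μ')) = Pi.single μ' 1 := hn μ'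
    simp only [ContinuousLinearMap.coe_coe, h0, hT, smul_zero, Finset.sum_const_zero, zero_add,
      hn', Finset.sum_apply, Pi.smul_apply, smul_eq_mul] at this
    rw [Matrix.mul_apply, Matrix.one_apply, ← Pi.single_apply μ' (1 : ℂ) μ, this]
    refine Finset.sum_congr rfl fun ν _ => ?_
    simp only [Matrix.of_apply]
    field_simp
  · funext μ α β
    rw [hsff']
    have e1 : ∀ w, D1 w = 0 → D2 (f' (iT β)) w =
        ∑ δ, f.repr (f' (iT β)) (iT δ) • D2 (f (iT δ)) w := fun w hw => by
      have := f.map_expand (D2.flip w).toLinearMap (f' (iT β))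
      simpa [hN, hself w hw] using this
    have e2 : ∀ δ, D2 (f (iT δ)) (f' (iT α)) =
        ∑ γ, f.repr (f' (iT α)) (iT γ) • D2 (f (iT δ)) (f (iT γ)) := fun δ => by
      have := f.map_expand (D2 (f (iT δ))).toLinearMap (f' (iT α))
      have h1 : D2 (f (iT δ)) (f iL) = 0 := by rw [hsymm, hself _ (hT δ)]
      simpa [hN, h1] using this
    rw [e1 _ (hT' α)]
    simp only [e2, Finset.sum_apply, Pi.smul_apply, smul_eq_mul, hD2, tensorAct, Matrix.of_apply,
      Finset.mul_sum, mul_neg, Finset.sum_neg_distrib, neg_neg]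
    rw [Finset.sum_comm]
    simp_rw [Finset.sum_comm (s := (Finset.univ : Finset (Fin n)))
      (t := (Finset.univ : Finset (Fin a)))]
    refine Finset.sum_congr rfl fun _ _ => Finset.sum_congr rfl fun _ _ =>
      Finset.sum_congr rfl fun _ _ => ?_
    ring

theorem IsGeneralPoint.eventually_coeff_eq_tensorAct (hX : IsAnalyticSubmanifold n a X)
    {f : Frame V n a} (hgen : IsGeneralPoint n a X (Frame.point f)) {G : ℂ → Frame V n a}
    {q : ℂ → Quad n a} (hG : IsAdaptedCurve X G) (hG0 : G 0 = f)
    (hq : ∀ᶠ t in 𝓝 (0 : ℂ), IsSecondFF X (G t) (q t)) :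
    ∀ᶠ t in 𝓝 (0 : ℂ), ∃ (A : Matrix (Fin n) (Fin n) ℂ) (B : Matrix (Fin a) (Fin a) ℂ),
      IsUnit A ∧ IsUnit B ∧ (q t).coeff = tensorAct (A, B) (q 0).coeff := by
  subst hG0
  -- Generality is stated near the chosen representative of the point, so the curve of vectors is
  -- rescaled by a constant to pass through it.
  obtain ⟨c, hc⟩ := Projectivization.exists_smul_eq_mk_rep ℂ (G 0 iL) ((G 0).ne_zero iL)
  have ht : Tendsto (fun t => (c : ℂ) • G t iL) (𝓝 0) (𝓝[cone X] (Frame.point (G 0)).rep) := by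
    refine tendsto_nhdsWithin_iff.2 ⟨?_, ?_⟩
    · have h1 : Tendsto (fun t => (c : ℂ) • G t iL) (𝓝 0) (𝓝 ((c : ℂ) • G 0 iL)) :=
        ((hG.1 iL).continuousAt.tendsto).const_smul (c : ℂ)
      have h2 : (c : ℂ) • G 0 iL = (Frame.point (G 0)).rep := hc
      rwa [h2] at h1
    · filter_upwards [hG.2] with t h
      exact (smul_mem_cone_iff c.ne_zero).2 h.mem_cone
  filter_upwards [ht.eventually hgen, hG.2, hq] with t h1 h2 h3
  have hne : (c : ℂ) • G t iL ≠ 0 := smul_ne_zero c.ne_zero ((G t).ne_zero iL)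
  obtain ⟨f₁, h, q', hf₁, hp₁, hq₁, hh, hph, hqh⟩ := h1 hne
  have hp : Frame.point (G t) = Frame.point f₁ := by
    rw [hp₁]
    exact ((Projectivization.mk_eq_mk_iff' ℂ _ _ hne ((G t).ne_zero iL)).2 ⟨c, rfl⟩).symm
  -- Generality gives frames over the moving point and over the base point with common coefficients
  -- `q'`. Comparing each with the frame of the curve over the same point links `q t` to `q 0`.
  obtain ⟨A, B, hA, hB, e⟩ := hX.exists_coeff_eq_tensorAct hf₁ h2 hp hq₁ h3
  obtain ⟨A', B', hA', hB', e'⟩ :=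
    hX.exists_coeff_eq_tensorAct hG.2.self_of_nhds hh hph hq.self_of_nhds hqh
  refine ⟨A * A', B * B', hA.mul hA', hB.mul hB', ?_⟩
  rw [e, e', ← tensorAct_mul]
  rfl

/-- At a general point, the Fubini cubic form lies in the space of choices imposed by the structure
equation. -/
theorem IsGeneralPoint.mem_admissible (hX : IsAnalyticSubmanifold n a X)
    {f : Frame V n a} (hf : IsAdapted X f) (hgen : IsGeneralPoint n a X (Frame.point f))
    {q : Quad n a} (hq : IsSecondFF X f q) {r : Cubic n a} (hr : IsFubiniCubic X f r) :
    r ∈ admissible q := by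
  obtain ⟨F₀, hF₀⟩ := hX.exists_isLocalEq hf.mem_cone
  obtain ⟨F, hF, hn⟩ := hF₀.exists_isNormalized hf
  have key : ∀ γ, ∃ u ∈ glDeg n a 0, ∀ μ α β, actII q u μ α β = r μ α β γ := by
    intro γ
    obtain ⟨G, hG, hG0, hw⟩ := hF.exists_isAdaptedCurve hf (Pi.single γ 1)
    obtain ⟨qt, hqt⟩ := hF.exists_isSecondFF_along hG hG0
    have hq0 : qt 0 = q := by
      have := hqt.self_of_nhds
      rw [hG0] at this
      exact hF.isSecondFF_unique hf this hq
    have hc : AnalyticAt ℂ (fun t => (qt t).coeff) 0 := by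
      refine AnalyticAt.pi fun μ => AnalyticAt.pi fun α => AnalyticAt.pi fun β => ?_
      exact analyticAt_pi_iff.1 (hF.analyticAt_coeff hG hG0 hqt α β) μ
    have horb := hgen.eventually_coeff_eq_tensorAct hX hG hG0 hqt
    rw [hq0] at horb
    obtain ⟨u, hu, hu'⟩ := exists_actII_eq_of_curve q hc.hasStrictDerivAt (by rw [hq0]) horb
    have hd : ∀ μ α β, deriv (fun t => (qt t).coeff μ α β) 0 = actII q u μ α β := by
      intro μ α β
      rw [hu']
      have := hc.differentiableAt.hasDerivAt
      exact (hasDerivAt_pi.1 (hasDerivAt_pi.1 (hasDerivAt_pi.1 this μ) α) β).deriv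
    -- `w` is the degree 0 part of the Maurer–Cartan form. The definition of the cubic reads `r =
    -- -dq + w.II`, and `dq = u.II` by tangency to the orbit, so `w - u` is the required value of
    -- `φ`.
    let w : Gl n a := Matrix.of fun i j => if level j = level i then maurerCartan G i j else 0
    refine ⟨w - u, sub_mem (fun i j hij => ?_) hu, fun μ α β => ?_⟩
    · exact if_neg fun h => hij (by rw [h, sub_self])
    · have := hr G qt hG hG0 hqt μ α β
      rw [hd, hq0] at this
      simp only [hw, Pi.single_apply, mul_ite, mul_one, mul_zero, Finset.sum_ite_eq',
        Finset.mem_univ, if_true] at this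
      rw [this, map_sub]
      simp only [Pi.sub_apply]
      have hw' : actII q w μ α β = - maurerCartan G iL iL * q.coeff μ α β
          - ∑ ν, q.coeff ν α β * maurerCartan G (iN μ) (iN ν)
          + ∑ δ, q.coeff μ α δ * maurerCartan G (iT δ) (iT β)
          + ∑ δ, q.coeff μ β δ * maurerCartan G (iT δ) (iT α) := by
        simp only [actII, LinearMap.coe_mk, AddHom.coe_mk, w, Matrix.of_apply, level, if_true,
          q.symm μ β, mul_comm (maurerCartan G _ _)]
        ring
      rw [hw']
      ring
  choose φ hφ hφr using key
  have e : r = cubicOf q φ := by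
    funext μ α β γ
    exact (hφr γ μ α β).symm
  refine ⟨φ, hφ, fun μ β γ δ => ?_, e⟩
  rw [hφr, hφr, (hF.isFubiniCubic_iff hf hn hq).1 hr, hF.cubicFormula_symm, sub_self]

end GeneralPoint

end FubiniCubic

namespace FubiniCubic

/-! ### Motions in the fibre and the resulting variation of the cubic. -/

section Motions

variable {V : Type*} [NormedAddCommGroup V] [NormedSpace ℂ V] {n a : ℕ}
  {X : Set (ℙ ℂ V)} {F : V → Fin a → ℂ} {f f' : Frame V n a}

/-- The frame `f'` is obtained from `f` by a motion in the fibre with component `A` in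
`𝔤𝔩(V)_1`. -/
def IsMotion (A : Gl n a) (f f' : Frame V n a) : Prop :=
  f' iL = f iL ∧ (∀ α, f' (iT α) = f (iT α) + A iL (iT α) • f iL) ∧
  ∃ b : Fin a → ℂ, ∀ μ, f' (iN μ) = f (iN μ) + ∑ γ, A (iT γ) (iN μ) • f (iT γ) + b μ • f iL

theorem SameGraded.exists_isMotion (h : SameGraded f f') :
    ∃ A ∈ glDeg n a 1, IsMotion A f f' := by
  obtain ⟨h0, hT, hN⟩ := h
  choose c hc using fun α => Submodule.mem_span_singleton.1 (hT α)
  choose b z hz hb using fun μ => Submodule.mem_span_insert.1 (hN μ)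
  choose k hk using fun μ => (Submodule.mem_span_range_iff_exists_fun ℂ).1 (hz μ)
  refine ⟨Matrix.of fun i j => match i, j with
    | Sum.inl _, Sum.inr (Sum.inl α) => c α
    | Sum.inr (Sum.inl γ), Sum.inr (Sum.inr μ) => k μ γ
    | _, _ => 0, ?_, h0, fun α => ?_, b, fun μ => ?_⟩
  · intro i j h
    rcases i with _ | _ | _ <;> rcases j with _ | _ | _ <;> simp_all [level]
  · rw [Matrix.of_apply, hc]
    abel
  · have e := hb μ
    rw [← hk] at e
    simp only [Matrix.of_apply]
    rw [add_assoc, add_comm (∑ γ, _), ← e]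
    abel

theorem IsMotion.sameGraded {A : Gl n a} (h : IsMotion A f f') : SameGraded f f' := by
  obtain ⟨h0, hT, b, hN⟩ := h
  refine ⟨h0, fun α => ?_, fun μ => ?_⟩
  · rw [hT, add_sub_cancel_left]
    exact Submodule.smul_mem _ _ (Submodule.mem_span_singleton_self _)
  · rw [hN, add_assoc, add_sub_cancel_left]
    refine add_mem (Submodule.sum_mem _ fun γ _ => Submodule.smul_mem _ _ ?_)
      (Submodule.smul_mem _ _ (Submodule.subset_span (Set.mem_insert _ _)))
    exact Submodule.subset_span (Set.mem_insert_of_mem _ ⟨γ, rfl⟩)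

theorem exists_isMotion (f : Frame V n a) {A : Gl n a} (hA : A ∈ glDeg n a 1) :
    ∃ f' : Frame V n a, IsMotion A f f' := by
  -- There are only three levels, so a product of three degree 1 elements vanishes; hence `1 + A` is
  -- invertible and carries `f` to a frame.
  have hnil : IsNilpotent A := by
    refine ⟨3, ?_⟩
    have h3 : A * A * A ∈ glDeg n a 3 := mul_mem_glDeg (k := 2) (l := 1)
      (mul_mem_glDeg (k := 1) (l := 1) hA hA) hA
    ext i j
    rw [pow_succ, pow_two]
    refine h3 i j ?_
    rcases i with _ | _ | _ <;> rcases j with _ | _ | _ <;> simp [level]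
  have hu : IsUnit (1 + A).det := (Matrix.isUnit_iff_isUnit_det _).1 hnil.isUnit_one_add
  let f' : Frame V n a := f.map (Matrix.toLinearEquiv f (1 + A) hu)
  have hf' : ∀ j, f' j = f j + ∑ i, A i j • f i := by
    intro j
    have : f' j = Matrix.toLin f f (1 + A) (f j) := rfl
    rw [this, Matrix.toLin_self]
    simp [Matrix.add_apply, add_smul, Finset.sum_add_distrib, Matrix.one_apply, ite_smul]
  have hz : ∀ i j, level j - level i ≠ 1 → A i j = 0 := hA
  have z0 : ∀ i, A i iL = 0 := fun i => hz _ _ (by rcases i with _ | _ | _ <;> simp [level])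
  have z1 : ∀ α β, A (iT β) (iT α) = 0 := fun _ _ => hz _ _ (by simp [level])
  have z2 : ∀ α μ, A (iN μ) (iT α) = 0 := fun _ _ => hz _ _ (by simp [level])
  have z3 : ∀ ν μ, A (iN μ) (iN ν) = 0 := fun _ _ => hz _ _ (by simp [level])
  have z4 : ∀ ν, A iL (iN ν) = 0 := fun _ => hz _ _ (by simp [level])
  refine ⟨f', ?_, fun α => ?_, 0, fun μ => ?_⟩
  · simp [hf', z0]
  · simp [hf', z1, z2]
  · simp [hf', z3, z4]

theorem IsMotion.isNormalized {A : Gl n a} (h : IsMotion A f f') (hn : IsNormalized F f)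
    (h0 : fderiv ℂ F (f iL) (f iL) = 0) (hT : ∀ α, fderiv ℂ F (f iL) (f (iT α)) = 0) :
    IsNormalized F f' := by
  obtain ⟨hL, -, b, hN⟩ := h
  intro μ
  rw [hL, hN]
  simp [h0, hT, hn μ]

variable [FiniteDimensional ℂ V]

theorem IsMotion.isAdapted {A : Gl n a} (h : IsMotion A f f') (hF : IsLocalEq X F (f iL))
    (hf : IsAdapted X f) : IsAdapted X f' := by
  obtain ⟨hv, hT⟩ := hF.isAdapted_iff.1 hf
  obtain ⟨hL, hT', -⟩ := h
  have hF' : IsLocalEq X F (f' iL) := hL ▸ hF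
  refine hF'.isAdapted_iff.2 ⟨hL ▸ hv, fun α => ?_⟩
  rw [hL, hT', map_add, map_smul, hT, hF.fderiv_self hv, smul_zero, add_zero]

/-- A motion changes the tangent vectors by multiples of `e_0`, which `D²F` annihilates against
tangent vectors. With the same `q` and the same normalized `F`, the two cubics are values of one
formula. -/
theorem IsMotion.isSecondFF {A : Gl n a} (h : IsMotion A f f') (hF : IsLocalEq X F (f iL))
    (hf : IsAdapted X f) (hn : IsNormalized F f) {q : Quad n a} (hq : IsSecondFF X f q) :
    IsSecondFF X f' q := by
  obtain ⟨hv, hT⟩ := hF.isAdapted_iff.1 hf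
  have h0 := hF.fderiv_self hv
  have hn' := h.isNormalized hn h0 hT
  have hsff := HasSFF.coeff_eq hn ((hF.isSecondFF_iff hf).1 hq)
  have hf' := h.isAdapted hF hf
  obtain ⟨hL, hT', -⟩ := h
  have hF' : IsLocalEq X F (f' iL) := hL ▸ hF
  refine (hF'.isSecondFF_iff hf').2 fun α β => ?_
  rw [hn'.normalMap_apply]
  funext μ
  have e1 : ∀ α, fderiv ℂ (fderiv ℂ F) (f iL) (f iL) (f (iT α)) = 0 := fun α =>
    hF.fderiv_fderiv_self hv (hT α)
  have e2 : fderiv ℂ (fderiv ℂ F) (f iL) (f (iT β)) (f iL) = 0 := by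
    rw [hF.fderiv_fderiv_symm, e1]
  rw [hL, hT', hT', hsff]
  simp [e1, e2, hF.fderiv_fderiv_self hv h0]

/-- Tangency persists along the ruling, so `D²F(s v)(v, w)` vanishes for `s` near 1; differentiate
at `s = 1`. -/
theorem IsLocalEq.third_self_self {v : V} (h : IsLocalEq X F v) (hv : v ∈ cone X) {w : V}
    (hw : fderiv ℂ F v w = 0) : fderiv ℂ (fderiv ℂ (fderiv ℂ F)) v v v w = 0 := by
  have hl : HasDerivAt (fun s : ℂ => s • v) v 1 :=
    ((hasDerivAt_id (1 : ℂ)).smul_const v).congr_deriv (one_smul _ _)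
  have ht : Tendsto (fun s : ℂ => s • v) (𝓝 1) (𝓝 v) := by
    have := hl.continuousAt.tendsto
    rwa [one_smul] at this
  have d0 := HasFDerivAt.comp_hasDerivAt_of_eq (1 : ℂ)
    h.analyticAt.fderiv.fderiv.differentiableAt.hasFDerivAt hl (one_smul _ _).symm
  have d1 := (d0.clm_apply (hasDerivAt_const (1 : ℂ) v)).clm_apply (hasDerivAt_const (1 : ℂ) w)
  have e : (fun s : ℂ => fderiv ℂ (fderiv ℂ F) (s • v) v w) =ᶠ[𝓝 1] fun _ => 0 := by
    filter_upwards [ht.eventually h.eventually, eventually_ne_nhds one_ne_zero,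
      h.eventually_fderiv_smul hv] with s h1 h2 h3
    have h4 := h1.fderiv_fderiv_self ((smul_mem_cone_iff h2).2 hv) (h3 w hw)
    rw [map_smul, smul_apply] at h4
    exact (smul_eq_zero.1 h4).resolve_left h2
  have := d1.unique ((hasDerivAt_const (1 : ℂ) (0 : Fin a → ℂ)).congr_of_eventuallyEq e)
  simpa using this

/-- The variation of the Fubini cubic form under a motion in the fibre. -/
theorem IsMotion.cubicFormula_sub {A : Gl n a} (hA : A ∈ glDeg n a 1) (h : IsMotion A f f')
    (hF : IsLocalEq X F (f iL)) (hf : IsAdapted X f) (hn : IsNormalized F f) {q : Quad n a}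
    (hq : IsSecondFF X f q) :
    cubicFormula F f' q - cubicFormula F f q = cubicMap q (adMap q A) := by
  obtain ⟨hv, hT⟩ := hF.isAdapted_iff.1 hf
  have h0 := hF.fderiv_self hv
  have hsff := HasSFF.coeff_eq hn ((hF.isSecondFF_iff hf).1 hq)
  obtain ⟨hL, hT', b, hN'⟩ := h
  funext μ α β γ
  -- The relation along the rulings, solved for the third derivative. In the variation its `D²F(e_0,
  -- e_ν)` terms cancel against those of `hD2`, leaving `A^0_γ q^μ_{αβ}` and its permutations; the
  -- degree 2 component `b` of the motion never enters.
  have heul : ∀ α β, fderiv ℂ (fderiv ℂ (fderiv ℂ F)) (f iL) (f iL) (f (iT β)) (f (iT α)) μ =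
      q.coeff μ α β - ∑ ν, q.coeff ν α β * fderiv ℂ (fderiv ℂ F) (f iL) (f iL) (f (iN ν)) μ := by
    intro α β
    have := congrFun (hF.third_self hf hq α β) μ
    simp only [Pi.add_apply, Finset.sum_apply, Pi.smul_apply, smul_eq_mul, hn _, Pi.single_apply,
      mul_ite, mul_one, mul_zero, Finset.sum_ite_eq, Finset.mem_univ, if_true] at this
    linear_combination this
  have e1 : ∀ α, fderiv ℂ (fderiv ℂ F) (f iL) (f iL) (f (iT α)) = 0 := fun α =>
    hF.fderiv_fderiv_self hv (hT α)
  have e2 : ∀ α, fderiv ℂ (fderiv ℂ F) (f iL) (f (iT α)) (f iL) = 0 := fun α => by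
    rw [hF.fderiv_fderiv_symm, e1]
  have e3 := hF.fderiv_fderiv_self hv h0
  have e4 : ∀ α β, fderiv ℂ (fderiv ℂ F) (f iL) (f (iT β)) (f (iT α)) μ = - q.coeff μ α β :=
    fun α β => by rw [hsff, neg_neg]
  have t0 : ∀ α, fderiv ℂ (fderiv ℂ (fderiv ℂ F)) (f iL) (f iL) (f iL) (f (iT α)) = 0 :=
    fun α => hF.third_self_self hv (hT α)
  have t1 : ∀ α, fderiv ℂ (fderiv ℂ (fderiv ℂ F)) (f iL) (f iL) (f (iT α)) (f iL) = 0 :=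
    fun α => by rw [hF.third_symm_right, t0]
  have t2 : ∀ α, fderiv ℂ (fderiv ℂ (fderiv ℂ F)) (f iL) (f (iT α)) (f iL) (f iL) = 0 :=
    fun α => by rw [hF.third_symm_left, t1]
  have t3 := hF.third_self_self hv h0
  have t4 : ∀ α β, fderiv ℂ (fderiv ℂ (fderiv ℂ F)) (f iL) (f (iT β)) (f iL) (f (iT α)) =
      fderiv ℂ (fderiv ℂ (fderiv ℂ F)) (f iL) (f iL) (f (iT β)) (f (iT α)) :=
    fun α β => hF.third_symm_left _ _ _
  have t5 : ∀ α β, fderiv ℂ (fderiv ℂ (fderiv ℂ F)) (f iL) (f (iT β)) (f (iT α)) (f iL) =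
      fderiv ℂ (fderiv ℂ (fderiv ℂ F)) (f iL) (f iL) (f (iT β)) (f (iT α)) :=
    fun α β => by rw [hF.third_symm_right, t4]
  have hD2 : ∀ γ ν, fderiv ℂ (fderiv ℂ F) (f iL) (f' (iT γ)) (f' (iN ν)) μ =
      fderiv ℂ (fderiv ℂ F) (f iL) (f (iT γ)) (f (iN ν)) μ
      - ∑ δ, A (iT δ) (iN ν) * q.coeff μ γ δ
      + A iL (iT γ) * fderiv ℂ (fderiv ℂ F) (f iL) (f iL) (f (iN ν)) μ := by
    intro γ ν
    rw [hT', hN']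
    simp [e1, e2, e3, e4, q.symm μ γ]
    ring
  have hD3 : fderiv ℂ (fderiv ℂ (fderiv ℂ F)) (f iL) (f' (iT γ)) (f' (iT β)) (f' (iT α)) μ =
      fderiv ℂ (fderiv ℂ (fderiv ℂ F)) (f iL) (f (iT γ)) (f (iT β)) (f (iT α)) μ +
      A iL (iT γ) * fderiv ℂ (fderiv ℂ (fderiv ℂ F)) (f iL) (f iL) (f (iT β)) (f (iT α)) μ +
      A iL (iT β) * fderiv ℂ (fderiv ℂ (fderiv ℂ F)) (f iL) (f iL) (f (iT γ)) (f (iT α)) μ +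
      A iL (iT α) * fderiv ℂ (fderiv ℂ (fderiv ℂ F)) (f iL) (f iL) (f (iT γ)) (f (iT β)) μ := by
    rw [hT', hT', hT']
    simp [t0, t1, t2, t3, t4, t5]
    ring
  have hc : cubicMap q (adMap q A) μ α β γ = actII q ⁅tangentEmb q (Pi.single γ 1), A⁆ μ α β := rfl
  rw [hc, actII_lie q hA]
  simp only [Pi.sub_apply, cubicFormula, hL, hD2, hD3, heul]
  have s : ∀ α β γ, ∑ ν, q.coeff ν α β * (fderiv ℂ (fderiv ℂ F) (f iL) (f (iT γ)) (f (iN ν)) μ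
      - ∑ δ, A (iT δ) (iN ν) * q.coeff μ γ δ
      + A iL (iT γ) * fderiv ℂ (fderiv ℂ F) (f iL) (f iL) (f (iN ν)) μ) =
      ∑ ν, q.coeff ν α β * fderiv ℂ (fderiv ℂ F) (f iL) (f (iT γ)) (f (iN ν)) μ
      - ∑ δ, ∑ ν, A (iT δ) (iN ν) * (q.coeff ν α β * q.coeff μ γ δ)
      + A iL (iT γ) *
        ∑ ν, q.coeff ν α β * fderiv ℂ (fderiv ℂ F) (f iL) (f iL) (f (iN ν)) μ := by
    intro α β γ
    rw [Finset.sum_comm]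
    simp only [mul_add, mul_sub, Finset.sum_add_distrib, Finset.sum_sub_distrib, Finset.mul_sum]
    congr 1
    · congr 1
      exact Finset.sum_congr rfl fun _ _ => Finset.sum_congr rfl fun _ _ => by ring
    · exact Finset.sum_congr rfl fun _ _ => by ring
  rw [s, s, s]
  simp only [mul_add, Finset.sum_add_distrib, q.symm _ γ α]
  ring

/-- Every motion has a degree 1 component and every degree 1 element is realized by a motion, so the
variations form the linear image of `𝔤𝔩(V)_1`. -/
theorem fiberVariations_eq (hX : IsAnalyticSubmanifold n a X) (hf : IsAdapted X f) {q : Quad n a}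
    (hq : IsSecondFF X f q) :
    fiberVariations X f =
      ((glDeg n a 1).map (cubicMap q ∘ₗ adMap q) : Submodule ℂ (Cubic n a)) := by
  obtain ⟨F₀, hF₀⟩ := hX.exists_isLocalEq hf.mem_cone
  obtain ⟨F, hF, hn⟩ := hF₀.exists_isNormalized hf
  obtain ⟨hv, hT⟩ := hF.isAdapted_iff.1 hf
  have key : ∀ {A : Gl n a} {f' : Frame V n a}, IsMotion A f f' → ∀ r,
      (IsFubiniCubic X f' r ↔ r = cubicFormula F f' q) := fun h r =>
    IsLocalEq.isFubiniCubic_iff (by rw [h.1]; exact hF) (h.isAdapted hF hf)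
      (h.isNormalized hn (hF.fderiv_self hv) hT) (h.isSecondFF hF hf hn hq)
  ext m
  constructor
  · rintro ⟨f', r, r', -, hs, hr, hr', rfl⟩
    obtain ⟨A, hA, h⟩ := hs.exists_isMotion
    refine ⟨A, hA, ?_⟩
    rw [(hF.isFubiniCubic_iff hf hn hq).1 hr, (key h r').1 hr', h.cubicFormula_sub hA hF hf hn hq]
    rfl
  · rintro ⟨A, hA, rfl⟩
    obtain ⟨f', h⟩ := exists_isMotion f hA
    exact ⟨f', _, _, h.isAdapted hF hf, h.sameGraded, (hF.isFubiniCubic_iff hf hn hq).2 rfl,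
      (key h _).2 rfl, (h.cubicFormula_sub hA hF hf hn hq).symm⟩

end Motions

end FubiniCubic

end

/-! ### Assembly of the geometric and algebraic halves. -/

theorem mainTheorem4 {V W : Type*}
    [NormedAddCommGroup V] [NormedSpace ℂ V] [FiniteDimensional ℂ V]
    [NormedAddCommGroup W] [NormedSpace ℂ W] [FiniteDimensional ℂ W]
    (n a : ℕ) (X : Set (ℙ ℂ V)) (hX : FubiniCubic.IsAnalyticSubmanifold n a X)
    (Z : Set (ℙ ℂ W)) (hZ : FubiniCubic.IsRankTwoCHSS Z)
    (x : ℙ ℂ V) (hx : x ∈ X) (z : ℙ ℂ W) (hz : z ∈ Z)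
    (hgen : FubiniCubic.IsGeneralPoint n a X x)
    (hII : FubiniCubic.SecondFFIso n a X x Z z)
    (f : FubiniCubic.Frame V n a) (hf : FubiniCubic.IsAdapted X f)
    (hfx : FubiniCubic.Frame.point f = x) :
    (∃! q : FubiniCubic.Quad n a, FubiniCubic.IsSecondFF X f q) ∧
    ∀ q : FubiniCubic.Quad n a, FubiniCubic.IsSecondFF X f q →
      (∃! r : FubiniCubic.Cubic n a, FubiniCubic.IsFubiniCubic X f r) ∧
      (∀ r, FubiniCubic.IsFubiniCubic X f r → r ∈ FubiniCubic.admissible q) ∧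
      ∃ M : Submodule ℂ (FubiniCubic.admissible q),
        ((M.map (FubiniCubic.admissible q).subtype : Submodule ℂ (FubiniCubic.Cubic n a)) :
          Set (FubiniCubic.Cubic n a)) = FubiniCubic.fiberVariations X f ∧
        ∃ e : (FubiniCubic.admissible q ⧸ M) ≃ₗ[ℂ] FubiniCubic.H1 q 1,
          ∀ r c, FubiniCubic.Corresponds q r c →
            e (Submodule.Quotient.mk r) = Submodule.Quotient.mk c := by
  obtain ⟨F₀, hF₀⟩ := hX.exists_isLocalEq hf.mem_cone
  obtain ⟨F, hF, hn⟩ := hF₀.exists_isNormalized hf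
  refine ⟨hF.existsUnique_isSecondFF hf, fun q hq => ⟨⟨FubiniCubic.cubicFormula F f q,
    hF.isFubiniCubic_cubicFormula hf hn hq, fun r hr => hF.isFubiniCubic_unique hf hr
      (hF.isFubiniCubic_cubicFormula hf hn hq)⟩,
    fun r hr => FubiniCubic.IsGeneralPoint.mem_admissible hX hf (hfx ▸ hgen) hq hr,
    FubiniCubic.motions q, ?_, FubiniCubic.exists_quotient_equiv q⟩⟩
  rw [FubiniCubic.map_motions, FubiniCubic.fiberVariations_eq hX hf hq]
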